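/- Let $(\Omega,\mathcal F,P)$ be a probability space carrying, for $i=1,2,\dots$, random variables $x_i\in\mathbb R^p$ and $D_i,\theta_i,y_i\in\mathbb R$. Suppose the Fay--Herriot model is correctly specified with true parameter $\psi_*=(\beta_*,A_*)$: for every $i$, $$\theta_i\mid x_i,D_i\sim N(x_i^\top\beta_*,A_*),\qquad y_i\mid \theta_i,x_i,D_i\sim N(\theta_i,D_i).$$ Assume: 1. the vectors $(y_i,x_i,D_i)$, $i\ge 1$, are independent and identically distributed, and there are constants $0<D_L\le D_U<\infty$ with $D_L\le D_i\le D_U$ almost surely; 2. $x_i\in\mathcal X$ almost surely for a bounded set $\mathcal X\subset\mathbb R^p$, and $E[x_ix_i^\top]$ is positive definite; 3. $\Psi\subset\mathbb R^p\times(0,\infty)$ is compact, $\psi_*\in\Psi$, and $A_*+D_L>(2\pi)^{-1}e^{-3}$. Let $\phi(\cdot;\mu,v)$ be the density of $N(\mu,v)$. For $\gamma\in(0,1]$, $\psi=(\beta,A)$, and $v_i=A+D_i$, put $$\mathcal D_\gamma(y_i;\psi)=\frac1\gamma\,\phi(y_i;x_i^\top\beta,v_i)^\gamma\,c_\gamma,\qquad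 \mathcal D_0(y_i;\psi)=\log\phi(y_i;x_i^\top\beta,v_i),$$ where $c_\gamma$ is, throughout, either $\{\int\phi(t;x_i^\top\beta,v_i)^{1+\gamma}dt\}^{-\gamma/(1+\gamma)}$ or $(2\pi v_i)^{\gamma^2/(2(1+\gamma))}$ (the two differ by a factor depending only on $\gamma$; the statement holds for either choice). Define $$\tilde\theta_i^{(\gamma)}(\psi)=y_i+D_i\frac{d}{dy_i}\mathcal D_\gamma(y_i;\psi),\qquad \tilde s_i^{2(\gamma)}(\psi)=D_i+D_i^2\frac{d^2}{dy_i^2}\mathcal D_\gamma(y_i;\psi).$$ Let $\Gamma\subset[0,1]$ be a fixed finite set containing $0$ and $1$. For $m\ge1$ and $\gamma\in\Gamma$ let $\hat\psi^{(\gamma)}$ be a (measurable) maximizer over $\Psi$ of $\sum_{i=1}^m\mathcal D_\gamma(y_i;\psi)$, and put $\hat\theta_i^{(\gamma)}=\tilde\theta_i^{(\gamma)}(\hat\psi^{(\gamma)})$ and $\hat s_i^{2(\gamma)}=\tilde s_i^{2(\gamma)}(\hat\psi^{(\gamma)})$. Let $\gamma_{op}$ be a (measurable) minimizer over $\gamma\in\Gamma$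 of $\sum_{i=1}^m\hat s_i^{2(\gamma)}$. For $\alpha\in(0,1)$ let $z_{\alpha/2}$ be the upper $\alpha/2$-quantile of $N(0,1)$ and $$\hat I_{i,1-\alpha}^{(\gamma)}=\bigl(\hat\theta_i^{(\gamma)}-z_{\alpha/2}\hat s_i^{(\gamma)},\ \hat\theta_i^{(\gamma)}+z_{\alpha/2}\hat s_i^{(\gamma)}\bigr),\qquad \hat s_i^{(\gamma)}=\sqrt{\max(\hat s_i^{2(\gamma)},0)}.$$ Then for every fixed $i$ and every $\alpha\in(0,1)$, $$P\bigl(\theta_i\in\hat I_{i,1-\alpha}^{(\gamma_{op})}\bigr)=1-\alpha+o(1)\qquad\text{as } m\to\infty.$$ -/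

import Mathlib

open MeasureTheory ProbabilityTheory Filter Topology

noncomputable section

namespace FayHerriot

/-- The covariate / coefficient space `ℝ^p`. -/
abbrev Cov (p : ℕ) : Type := EuclideanSpace ℝ (Fin p)

/-- The parameter space `ℝ^p × ℝ`; a parameter is `ψ = (β, A)`. -/
abbrev Param (p : ℕ) : Type := Cov p × ℝ

/-- The normal density `φ(y; μ, v)` with mean `μ` and variance `v`. -/
def phi (y μ v : ℝ) : ℝ := gaussianPDFReal μ v.toNNReal y

/-- The normalising factor of the `γ`-divergence, `(∫ φ(t; μ, v)^(1+γ) dt)^(-γ/(1+γ))`. -/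
def normIntegral (γ μ v : ℝ) : ℝ := (∫ t : ℝ, phi t μ v ^ (1 + γ)) ^ (-(γ / (1 + γ)))

/-- The closed form `(2πv)^(γ²/(2(1+γ)))`. It differs from `normIntegral` by the factor
`(1+γ)^(γ/(2(1+γ)))`, which depends on `γ` only. -/
def normClosed (γ _μ v : ℝ) : ℝ := (2 * Real.pi * v) ^ (γ ^ 2 / (2 * (1 + γ)))

/-- The generalized log-likelihood `𝒟_γ` of one observation `y` with marginal law `N(μ, v)`, for the
normalising factor `c`; for `γ = 0` it is the marginal log-likelihood. -/
def genLogLik (c : ℝ → ℝ → ℝ → ℝ) (γ μ v y : ℝ) : ℝ :=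
  if γ = 0 then Real.log (phi y μ v) else 1 / γ * phi y μ v ^ γ * c γ μ v

/-- `𝒟_γ(y; ψ)` for an area with covariate `x` and sampling variance `d`: the marginal law of `y`
is `N(xᵀβ, A + d)`. -/
def areaLik {p : ℕ} (c : ℝ → ℝ → ℝ → ℝ) (γ : ℝ) (ψ : Param p) (x : Cov p) (d y : ℝ) : ℝ :=
  genLogLik c γ (inner ℝ x ψ.1) (ψ.2 + d) y

/-- Robust posterior mean (Tweedie's formula): `y + d · ∂_y 𝒟_γ(y; ψ)`. -/
def postMean {p : ℕ} (c : ℝ → ℝ → ℝ → ℝ) (γ : ℝ) (ψ : Param p) (x : Cov p) (d y : ℝ) : ℝ :=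
  y + d * deriv (fun t => areaLik c γ ψ x d t) y

/-- Robust posterior variance (Tweedie's formula): `d + d² · ∂_y² 𝒟_γ(y; ψ)`. -/
def postVar {p : ℕ} (c : ℝ → ℝ → ℝ → ℝ) (γ : ℝ) (ψ : Param p) (x : Cov p) (d y : ℝ) : ℝ :=
  d + d ^ 2 * iteratedDeriv 2 (fun t => areaLik c γ ψ x d t) y

/-- The upper `q`-quantile of the standard normal distribution. -/
def upperQuantile (q : ℝ) : ℝ := sInf {t : ℝ | 1 - q ≤ cdf (gaussianReal 0 1) t}

/-- The robust confidence interval of nominal level `1 - α`, for parameter value `ψ`. -/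
def robustInterval {p : ℕ} (c : ℝ → ℝ → ℝ → ℝ) (α γ : ℝ) (ψ : Param p) (x : Cov p) (d y : ℝ) :
    Set ℝ :=
  Set.Ioo (postMean c γ ψ x d y - upperQuantile (α / 2) * √(postVar c γ ψ x d y))
    (postMean c γ ψ x d y + upperQuantile (α / 2) * √(postVar c γ ψ x d y))

/-- `ψ` maximizes `∑_{j<m} 𝒟_γ(y_j; ·)` over the parameter space `Ψ`. -/
def IsGammaEstimate {p : ℕ} (c : ℝ → ℝ → ℝ → ℝ) (Ψ : Set (Param p)) (γ : ℝ) (m : ℕ)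
    (x : ℕ → Cov p) (D y : ℕ → ℝ) (ψ : Param p) : Prop :=
  ψ ∈ Ψ ∧ ∀ ψ' ∈ Ψ, ∑ j ∈ Finset.range m, areaLik c γ ψ' (x j) (D j) (y j) ≤
    ∑ j ∈ Finset.range m, areaLik c γ ψ (x j) (D j) (y j)

/-- `g` minimizes over `Γ` the total robust variance `∑_{j<m} ŝ_j^{2(γ)}`, where `ψhat γ` is the
estimate belonging to `γ`. -/
def IsOptimalGamma {p : ℕ} (c : ℝ → ℝ → ℝ → ℝ) (Γ : Finset ℝ) (m : ℕ) (ψhat : ℝ → Param p)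
    (x : ℕ → Cov p) (D y : ℕ → ℝ) (g : ℝ) : Prop :=
  g ∈ Γ ∧ ∀ γ ∈ Γ, ∑ j ∈ Finset.range m, postVar c g (ψhat g) (x j) (D j) (y j) ≤
    ∑ j ∈ Finset.range m, postVar c γ (ψhat γ) (x j) (D j) (y j)

/-- The correctly specified two-stage normal model for one area: given `(x, D)`,
`θ ~ N(xᵀβ, A)`, and given `(x, D, θ)`, `y ~ N(θ, D)`. -/
structure IsModel {Ω : Type*} [MeasurableSpace Ω] (P : Measure Ω) [IsFiniteMeasure P] {p : ℕ}
    (β : Cov p) (A : ℝ) (x : Ω → Cov p) (D θ y : Ω → ℝ) : Prop where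
  area_level : ∀ᵐ z ∂(P.map fun ω => (x ω, D ω)),
    condDistrib θ (fun ω => (x ω, D ω)) P z = gaussianReal (inner ℝ z.1 β) A.toNNReal
  sampling_level : ∀ᵐ z ∂(P.map fun ω => (x ω, D ω, θ ω)),
    condDistrib y (fun ω => (x ω, D ω, θ ω)) P z = gaussianReal z.2.2 z.2.1.toNNReal

end FayHerriot

end

/-! ### Explicit formulas for the generalized likelihood and its derivatives in `y`. -/

namespace FayHerriot

/-! Under a correct model robustness is not needed, and the selection rule detects this: almost
surely the selected `γ` is eventually `0`, so the interval becomes the classical empirical Bayes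
interval, whose limit has exact coverage by normal conjugacy.

Two population inequalities carry the selection step. Given `(x, D)`, the observation is normal with
variance `w = A + D`, so expectations of Gaussian bumps are explicit after completing the square.
First, for every `γ` the expected likelihood is uniquely maximal at the truth
(`integral_likForm_lt`, with `eq_zero_of_inner_ae_eq_zero` for identifiability), so every estimator
is strongly consistent (`tendsto_estimate`). Second, at the truth the expected curvature for `γ > 0`
is strictly below its value `1/w` for `γ = 0` (`integral_curvForm_lt`); this is where the lower
bound on `A + DL` enters. A uniform strong law transfers both inequalities to the sample averages,
and finiteness of `Γ` gives `eventually_optimalGamma_eq_zero`.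

For coverage, a rotation of the two independent model errors shows that the posterior error at the
truth is exactly standard normal after scaling (`map_posterior`). Consistency makes the interval
endpoints converge almost surely, and `θ i` almost surely avoids the limiting endpoints, so the
probabilities converge. The estimators need not be independent of area `i`. -/

theorem phi_of_pos {v : ℝ} (hv : 0 < v) (y μ : ℝ) :
    phi y μ v = (√(2 * Real.pi * v))⁻¹ * Real.exp (-(y - μ) ^ 2 / (2 * v)) := by
  simp [phi, gaussianPDFReal, Real.coe_toNNReal v hv.le]

theorem phi_rpow {v : ℝ} (hv : 0 < v) (γ y μ : ℝ) :
    phi y μ v ^ γ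
      = (2 * Real.pi * v) ^ (-(γ / 2)) * Real.exp (-(γ * (y - μ) ^ 2 / (2 * v))) := by
  have h2 : 0 < 2 * Real.pi * v := by positivity
  rw [phi_of_pos hv, Real.mul_rpow (by positivity) (by positivity), ← Real.exp_mul,
    Real.sqrt_eq_rpow, ← Real.rpow_neg h2.le, ← Real.rpow_mul h2.le]
  congr 2 <;> ring

theorem log_phi {v : ℝ} (hv : 0 < v) (y μ : ℝ) :
    Real.log (phi y μ v) = -(1 / 2) * Real.log (2 * Real.pi * v) - (y - μ) ^ 2 / (2 * v) := by
  have h2 : 0 < 2 * Real.pi * v := by positivity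
  rw [phi_of_pos hv, Real.log_mul (by positivity) (by positivity), Real.log_inv, Real.log_exp,
    Real.log_sqrt h2.le]
  ring

theorem integral_phi_rpow {v γ : ℝ} (hv : 0 < v) (hγ : 0 < 1 + γ) (μ : ℝ) :
    ∫ t : ℝ, phi t μ v ^ (1 + γ) = (2 * Real.pi * v) ^ (-(γ / 2)) * (1 + γ) ^ (-(1 / 2) : ℝ) := by
  have h2 : 0 < 2 * Real.pi * v := by positivity
  have hb : ∀ t : ℝ, Real.exp (-((1 + γ) * (t - μ) ^ 2 / (2 * v)))
      = Real.exp (-((1 + γ) / (2 * v)) * (t - μ) ^ 2) := fun t => by congr 1; ring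
  simp_rw [phi_rpow hv, hb]
  rw [integral_const_mul,
    integral_sub_right_eq_self (fun t : ℝ => Real.exp (-((1 + γ) / (2 * v)) * t ^ 2)) μ,
    integral_gaussian]
  have : Real.pi / ((1 + γ) / (2 * v)) = 2 * Real.pi * v * (1 + γ)⁻¹ := by field_simp
  rw [this, Real.sqrt_eq_rpow, Real.mul_rpow h2.le (by positivity), ← mul_assoc,
    ← Real.rpow_add h2, Real.inv_rpow hγ.le, ← Real.rpow_neg hγ.le]
  congr 2; ring

theorem normIntegral_eq {v γ : ℝ} (hv : 0 < v) (hγ : 0 < 1 + γ) (μ : ℝ) :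
    normIntegral γ μ v = (1 + γ) ^ (γ / (2 * (1 + γ))) * normClosed γ μ v := by
  have h2 : 0 < 2 * Real.pi * v := by positivity
  rw [normIntegral, integral_phi_rpow hv hγ, Real.mul_rpow (by positivity) (by positivity),
    ← Real.rpow_mul h2.le, ← Real.rpow_mul hγ.le, normClosed, mul_comm]
  congr 2 <;> field_simp

/-- `c` is `k(γ)` times the closed form, where `k` is positive and at most the constant of the
integral form. -/
structure IsNormFactor (c : ℝ → ℝ → ℝ → ℝ) (k : ℝ → ℝ) : Prop where
  zero : k 0 = 1
  pos : ∀ γ, 0 ≤ γ → 0 < k γ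
  le : ∀ γ, 0 ≤ γ → k γ ≤ (1 + γ) ^ (γ / (2 * (1 + γ)))
  eq : ∀ γ μ v, 0 ≤ γ → 0 < v → c γ μ v = k γ * normClosed γ μ v

/-- Treats both normalising factors at once. The constant `k γ` does not move the maximizer of the
likelihood; its size matters only when posterior variances are compared, where the integral form is
the worst case. -/
theorem exists_isNormFactor {c : ℝ → ℝ → ℝ → ℝ} (hc : c = normIntegral ∨ c = normClosed) :
    ∃ k, IsNormFactor c k := by
  rcases hc with rfl | rfl
  · exact ⟨fun γ => (1 + γ) ^ (γ / (2 * (1 + γ))), by simp, fun γ h => by positivity,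
      fun γ _ => le_rfl, fun γ μ v h hv => normIntegral_eq hv (by linarith) μ⟩
  · exact ⟨fun _ => 1, rfl, fun _ _ => one_pos,
      fun γ h => Real.one_le_rpow (by linarith) (by positivity), fun γ μ v _ _ => (one_mul _).symm⟩

/-- The power of the marginal variance left in the generalized likelihood. -/
noncomputable def varWeight (γ v : ℝ) : ℝ := (2 * Real.pi * v) ^ (-(γ / (2 * (1 + γ))))

theorem varWeight_pos {v : ℝ} (hv : 0 < v) (γ : ℝ) : 0 < varWeight γ v := by
  unfold varWeight; positivity

theorem varWeight_zero (v : ℝ) : varWeight 0 v = 1 := by simp [varWeight]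

/-- Explicit form of the generalized log-likelihood. -/
noncomputable def likForm (k γ μ v y : ℝ) : ℝ :=
  if γ = 0 then -(1 / 2) * Real.log (2 * Real.pi * v) - (y - μ) ^ 2 / (2 * v)
  else k / γ * varWeight γ v * Real.exp (-(γ * (y - μ) ^ 2 / (2 * v)))

/-- Explicit form of minus the second derivative in `y` of the generalized log-likelihood. -/
noncomputable def curvForm (k γ μ v y : ℝ) : ℝ :=
  k * varWeight γ v * v⁻¹ * ((1 - γ * ((y - μ) ^ 2 / v)) * Real.exp (-(γ * (y - μ) ^ 2 / (2 * v))))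

theorem genLogLik_eq {c : ℝ → ℝ → ℝ → ℝ} {k : ℝ → ℝ} (hk : IsNormFactor c k) {γ v : ℝ}
    (hγ : 0 ≤ γ) (hv : 0 < v) (μ y : ℝ) : genLogLik c γ μ v y = likForm (k γ) γ μ v y := by
  unfold genLogLik likForm
  split_ifs with h
  · exact log_phi hv y μ
  · have h2 : 0 < 2 * Real.pi * v := by positivity
    rw [phi_rpow hv, hk.eq γ μ v hγ hv, normClosed, varWeight]
    have : -(γ / (2 * (1 + γ))) = -(γ / 2) + γ ^ 2 / (2 * (1 + γ)) := by
      have : (1 + γ) ≠ 0 := by positivity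
      field_simp; ring
    rw [this, Real.rpow_add h2]; ring

/-- The division by `γ` in the likelihood cancels on differentiation, so with `k 0 = 1` a single
formula covers `γ = 0` as well. -/
theorem hasDerivAt_likForm {k : ℝ → ℝ} (hk : k 0 = 1) {γ v : ℝ} (hv : 0 < v) (μ y : ℝ) :
    HasDerivAt (likForm (k γ) γ μ v)
      (-(k γ * varWeight γ v * ((y - μ) / v) * Real.exp (-(γ * (y - μ) ^ 2 / (2 * v))))) y := by
  have h1 : HasDerivAt (fun y : ℝ => (y - μ) ^ 2 / (2 * v)) ((y - μ) / v) y := by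
    refine ((((hasDerivAt_id y).sub_const μ).pow 2).div_const (2 * v)).congr_deriv ?_
    simp; field_simp
  by_cases h : γ = 0
  · subst h
    have : likForm (k 0) 0 μ v
        = fun y => -(1 / 2) * Real.log (2 * Real.pi * v) - (y - μ) ^ 2 / (2 * v) := by
      funext y; simp [likForm]
    rw [this]
    refine (h1.const_sub _).congr_deriv ?_
    simp [hk, varWeight_zero]
  · have : likForm (k γ) γ μ v
        = fun y => k γ / γ * varWeight γ v * Real.exp (-(γ * ((y - μ) ^ 2 / (2 * v)))) := by
      funext y; simp [likForm, h, mul_div_assoc]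
    rw [this]
    refine (((h1.const_mul γ).neg.exp).const_mul (k γ / γ * varWeight γ v)).congr_deriv ?_
    simp only [Pi.neg_apply]
    rw [mul_div_assoc γ]; field_simp

theorem hasDerivAt_deriv_likForm (k γ : ℝ) {v : ℝ} (hv : 0 < v) (μ y : ℝ) :
    HasDerivAt (fun y => -(k * varWeight γ v * ((y - μ) / v)
      * Real.exp (-(γ * (y - μ) ^ 2 / (2 * v))))) (-curvForm k γ μ v y) y := by
  have h1 : HasDerivAt (fun y : ℝ => γ * (y - μ) ^ 2 / (2 * v)) (γ * ((y - μ) / v)) y := by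
    refine (((((hasDerivAt_id y).sub_const μ).pow 2).const_mul γ).div_const (2 * v)).congr_deriv ?_
    simp; field_simp
  have h2 : HasDerivAt (fun y : ℝ => k * varWeight γ v * ((y - μ) / v))
      (k * varWeight γ v * (1 / v)) y :=
    (((hasDerivAt_id y).sub_const μ).div_const v).const_mul _
  refine (h2.mul h1.neg.exp).neg.congr_deriv ?_
  simp only [curvForm, Pi.neg_apply]; field_simp; ring

variable {p : ℕ} {c : ℝ → ℝ → ℝ → ℝ} {k : ℝ → ℝ}

theorem areaLik_eq (hk : IsNormFactor c k) {γ : ℝ} (hγ : 0 ≤ γ) {ψ : Param p} {d : ℝ}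
    (hv : 0 < ψ.2 + d) (x : Cov p) (y : ℝ) :
    areaLik c γ ψ x d y = likForm (k γ) γ (inner ℝ x ψ.1) (ψ.2 + d) y :=
  genLogLik_eq hk hγ hv _ _

theorem deriv_areaLik (hk : IsNormFactor c k) {γ : ℝ} (hγ : 0 ≤ γ) {ψ : Param p} {d : ℝ}
    (hv : 0 < ψ.2 + d) (x : Cov p) :
    deriv (fun t => areaLik c γ ψ x d t) = fun y =>
      -(k γ * varWeight γ (ψ.2 + d) * ((y - inner ℝ x ψ.1) / (ψ.2 + d))
      * Real.exp (-(γ * (y - inner ℝ x ψ.1) ^ 2 / (2 * (ψ.2 + d))))) := by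
  simp_rw [areaLik_eq hk hγ hv]
  funext y
  exact (hasDerivAt_likForm hk.zero hv _ y).deriv

theorem postVar_eq (hk : IsNormFactor c k) {γ : ℝ} (hγ : 0 ≤ γ) {ψ : Param p} {d : ℝ}
    (hv : 0 < ψ.2 + d) (x : Cov p) (y : ℝ) :
    postVar c γ ψ x d y = d - d ^ 2 * curvForm (k γ) γ (inner ℝ x ψ.1) (ψ.2 + d) y := by
  rw [postVar, iteratedDeriv_succ, iteratedDeriv_one, deriv_areaLik hk hγ hv,
    (hasDerivAt_deriv_likForm (k γ) γ hv _ y).deriv]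
  ring

theorem curvForm_zero (μ v y : ℝ) : curvForm 1 0 μ v y = v⁻¹ := by simp [curvForm, varWeight_zero]

theorem postVar_zero (hk : IsNormFactor c k) {ψ : Param p} {d : ℝ}
    (hv : 0 < ψ.2 + d) (x : Cov p) (y : ℝ) :
    postVar c 0 ψ x d y = d - d ^ 2 / (ψ.2 + d) := by
  rw [postVar_eq hk le_rfl hv, hk.zero, curvForm_zero, div_eq_mul_inv]

theorem postMean_zero (hk : IsNormFactor c k) {ψ : Param p} {d : ℝ}
    (hv : 0 < ψ.2 + d) (x : Cov p) (y : ℝ) :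
    postMean c 0 ψ x d y = y - d * ((y - inner ℝ x ψ.1) / (ψ.2 + d)) := by
  rw [postMean, deriv_areaLik hk le_rfl hv]
  simp [hk.zero, varWeight_zero, sub_eq_add_neg]

end FayHerriot

/-! ### Gaussian integrals: expected likelihood and expected curvature. -/

namespace FayHerriot

/-- Completing the square in the product of the standard normal density and a Gaussian bump. -/
theorem gaussianPDFReal_mul_exp {γ v s : ℝ} (hγ : 0 ≤ γ) (hv : 0 < v) (δ r : ℝ) :
    gaussianPDFReal 0 1 r * Real.exp (-(γ * (δ + s * r) ^ 2 / (2 * v)))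
      = (√(1 + γ * s ^ 2 / v))⁻¹ * Real.exp (-(γ * δ ^ 2 / (2 * (v + γ * s ^ 2))))
        * gaussianPDFReal (-(γ * δ * s / (v + γ * s ^ 2))) (1 + γ * s ^ 2 / v)⁻¹.toNNReal r := by
  have ha : 0 < 1 + γ * s ^ 2 / v := by positivity
  have hb : 0 < v + γ * s ^ 2 := by positivity
  simp only [gaussianPDFReal, Real.coe_toNNReal _ (inv_pos.2 ha).le, NNReal.coe_one, mul_one]
  rw [Real.sqrt_mul (x := 2 * Real.pi) (by positivity) (1 + γ * s ^ 2 / v)⁻¹, Real.sqrt_inv]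
  have e : Real.exp (-(r - 0) ^ 2 / 2) * Real.exp (-(γ * (δ + s * r) ^ 2 / (2 * v)))
      = Real.exp (-(γ * δ ^ 2 / (2 * (v + γ * s ^ 2))))
        * Real.exp (-(r - -(γ * δ * s / (v + γ * s ^ 2))) ^ 2 / (2 * (1 + γ * s ^ 2 / v)⁻¹)) := by
    rw [← Real.exp_add, ← Real.exp_add]
    congr 1
    have : 1 + γ * s ^ 2 / v = (v + γ * s ^ 2) / v := by field_simp
    rw [this]
    field_simp
    ring
  rw [mul_assoc, e, mul_inv, inv_inv]
  have hs : √(1 + γ * s ^ 2 / v) ≠ 0 := (Real.sqrt_pos.2 ha).ne'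
  field_simp

/-- The bump tilts the standard normal law into another normal law. The free factor `g` serves both
the likelihood (`g = 1`) and the curvature (`g r = 1 - γ r²`). -/
theorem integral_mul_exp_gaussianReal {γ v s : ℝ} (hγ : 0 ≤ γ) (hv : 0 < v) (δ : ℝ)
    (g : ℝ → ℝ) :
    ∫ r, g r * Real.exp (-(γ * (δ + s * r) ^ 2 / (2 * v))) ∂gaussianReal 0 1
      = (√(1 + γ * s ^ 2 / v))⁻¹ * Real.exp (-(γ * δ ^ 2 / (2 * (v + γ * s ^ 2))))
        * ∫ r, g r ∂gaussianReal (-(γ * δ * s / (v + γ * s ^ 2)))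
            (1 + γ * s ^ 2 / v)⁻¹.toNNReal := by
  have ha : 0 < 1 + γ * s ^ 2 / v := by positivity
  rw [integral_gaussianReal_eq_integral_smul one_ne_zero,
    integral_gaussianReal_eq_integral_smul (Real.toNNReal_pos.2 (inv_pos.2 ha)).ne',
    ← integral_const_mul]
  congr 1 with r
  simp only [smul_eq_mul]
  rw [mul_left_comm, gaussianPDFReal_mul_exp hγ hv]
  ring

theorem integral_exp_gaussianReal {γ v s : ℝ} (hγ : 0 ≤ γ) (hv : 0 < v) (δ : ℝ) :
    ∫ r, Real.exp (-(γ * (δ + s * r) ^ 2 / (2 * v))) ∂gaussianReal 0 1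
      = (√(1 + γ * s ^ 2 / v))⁻¹ * Real.exp (-(γ * δ ^ 2 / (2 * (v + γ * s ^ 2)))) := by
  simpa using integral_mul_exp_gaussianReal hγ hv (s := s) δ (fun _ => (1 : ℝ))

theorem integral_sq_gaussianReal (w : NNReal) : ∫ r, r ^ 2 ∂gaussianReal 0 w = w := by
  have h := variance_id_gaussianReal (μ := 0) (v := w)
  rw [variance_of_integral_eq_zero aemeasurable_id (by simp)] at h
  simpa using h

theorem integrable_sq_gaussianReal (w : NNReal) :
    Integrable (fun r : ℝ => r ^ 2) (gaussianReal 0 w) := by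
  have := (memLp_id_gaussianReal (μ := 0) (v := w) 2).integrable_sq
  simpa using this

theorem integrable_id_gaussianReal (w : NNReal) :
    Integrable (fun r : ℝ => r) (gaussianReal 0 w) := by
  have := (memLp_id_gaussianReal (μ := 0) (v := w) 1).integrable le_rfl
  exact this

theorem integral_affine_sq_gaussianReal (δ s : ℝ) :
    ∫ r, (δ + s * r) ^ 2 ∂gaussianReal 0 1 = δ ^ 2 + s ^ 2 := by
  have h : ∀ r : ℝ, (δ + s * r) ^ 2 = (δ ^ 2 + 2 * δ * s * r) + s ^ 2 * r ^ 2 := fun r => by ring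
  simp_rw [h]
  have h1 : Integrable (fun r : ℝ => δ ^ 2 + 2 * δ * s * r) (gaussianReal 0 1) :=
    (integrable_const _).add ((integrable_id_gaussianReal 1).const_mul _)
  rw [integral_add h1 ((integrable_sq_gaussianReal 1).const_mul _), integral_add (integrable_const _)
    ((integrable_id_gaussianReal 1).const_mul _), integral_const_mul, integral_const_mul,
    integral_sq_gaussianReal]
  simp

theorem integrable_affine_sq_gaussianReal (δ s : ℝ) :
    Integrable (fun r : ℝ => (δ + s * r) ^ 2) (gaussianReal 0 1) := by
  have h : ∀ r : ℝ, (δ + s * r) ^ 2 = (δ ^ 2 + 2 * δ * s * r) + s ^ 2 * r ^ 2 := fun r => by ring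
  simp_rw [h]
  exact (((integrable_const _).add ((integrable_id_gaussianReal 1).const_mul _))).add
    ((integrable_sq_gaussianReal 1).const_mul _)

theorem integral_likForm_zero {v w : ℝ} (hw : 0 < w) (k μ ν : ℝ) :
    ∫ r, likForm k 0 μ v (ν + √w * r) ∂gaussianReal 0 1
      = -(1 / 2) * Real.log (2 * Real.pi * v) - ((ν - μ) ^ 2 + w) / (2 * v) := by
  have h : ∀ r : ℝ, ν + √w * r - μ = (ν - μ) + √w * r := fun r => by ring
  simp only [likForm, if_true, h]
  rw [integral_sub (integrable_const _) ((integrable_affine_sq_gaussianReal _ _).div_const _),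
    integral_div, integral_affine_sq_gaussianReal, Real.sq_sqrt hw.le]
  simp

theorem integral_likForm_pos {γ v w : ℝ} (hγ : 0 < γ) (hv : 0 < v) (hw : 0 < w) (k μ ν : ℝ) :
    ∫ r, likForm k γ μ v (ν + √w * r) ∂gaussianReal 0 1
      = k / γ * (varWeight γ v * (√(1 + γ * w / v))⁻¹)
        * Real.exp (-(γ * (ν - μ) ^ 2 / (2 * (v + γ * w)))) := by
  have h : ∀ r : ℝ, ν + √w * r - μ = (ν - μ) + √w * r := fun r => by ring
  simp only [likForm, hγ.ne', if_false, h]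
  rw [integral_const_mul, integral_exp_gaussianReal hγ.le hv, Real.sq_sqrt hw.le]
  ring

/-- The variance profile of the expected `γ`-likelihood is maximal exactly at the true variance. -/
theorem varWeight_mul_lt {γ v w : ℝ} (hγ : 0 < γ) (hv : 0 < v) (hw : 0 < w) (hne : v ≠ w) :
    varWeight γ v * (√(1 + γ * w / v))⁻¹ < varWeight γ w * (√(1 + γ * w / w))⁻¹ := by
  have hγ1 : 0 < 1 + γ := by linarith
  have h1 : 1 + γ * w / w = 1 + γ := by field_simp
  have hu : 0 < 1 + γ * w / v := by positivity
  rw [h1]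
  have hab : 1 / (1 + γ) + γ / (1 + γ) = 1 := by field_simp
  have hne1 : (1 : ℝ) ≠ w / v := fun h => hne (by field_simp at h; exact h)
  -- After taking logarithms the claim is strict Jensen for `log` at the points `1` and `w / v` with
  -- weights `1/(1+γ)` and `γ/(1+γ)`.
  have key : _ < _ := (strictConcaveOn_log_Ioi).2 (Set.mem_Ioi.2 one_pos)
    (Set.mem_Ioi.2 (div_pos hw hv)) hne1 (by positivity : 0 < 1 / (1 + γ))
    (by positivity : 0 < γ / (1 + γ)) hab
  simp only [smul_eq_mul, Real.log_one, mul_zero, zero_add, mul_one] at key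
  have e : 1 / (1 + γ) + γ / (1 + γ) * (w / v) = (1 + γ * w / v) / (1 + γ) := by field_simp
  rw [e, Real.log_div hu.ne' hγ1.ne', Real.log_div hw.ne' hv.ne'] at key
  have h2 : 0 < 2 * Real.pi := by positivity
  rw [← Real.log_lt_log_iff (mul_pos (varWeight_pos hv γ) (inv_pos.2 (Real.sqrt_pos.2 hu)))
    (mul_pos (varWeight_pos hw γ) (inv_pos.2 (Real.sqrt_pos.2 hγ1))),
    Real.log_mul (varWeight_pos hv γ).ne' (inv_pos.2 (Real.sqrt_pos.2 hu)).ne',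
    Real.log_mul (varWeight_pos hw γ).ne' (inv_pos.2 (Real.sqrt_pos.2 hγ1)).ne',
    Real.log_inv, Real.log_inv, Real.log_sqrt hu.le, Real.log_sqrt hγ1.le, varWeight, varWeight,
    Real.log_rpow (by positivity), Real.log_rpow (by positivity), Real.log_mul h2.ne' hv.ne',
    Real.log_mul h2.ne' hw.ne']
  have e2 : γ / (2 * (1 + γ)) = γ / (1 + γ) / 2 := by field_simp
  rw [e2]
  linarith

/-- The expected generalized likelihood under `N(ν, w)` is uniquely maximized at the truth. -/
theorem integral_likForm_lt {k γ v w μ ν : ℝ} (hk : 0 < k) (hγ : 0 ≤ γ) (hv : 0 < v)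
    (hw : 0 < w) (hne : (μ, v) ≠ (ν, w)) :
    ∫ r, likForm k γ μ v (ν + √w * r) ∂gaussianReal 0 1
      < ∫ r, likForm k γ ν w (ν + √w * r) ∂gaussianReal 0 1 := by
  rcases hγ.eq_or_lt with rfl | hγ
  · rw [integral_likForm_zero hw, integral_likForm_zero hw]
    have h2 : 0 < 2 * Real.pi := by positivity
    rw [Real.log_mul h2.ne' hv.ne', Real.log_mul h2.ne' hw.ne']
    have hww : ((ν - ν) ^ 2 + w) / (2 * w) = 1 / 2 := by field_simp; simp
    have hvw : ((ν - μ) ^ 2 + w) / (2 * v) = (ν - μ) ^ 2 / (2 * v) + w / v / 2 := by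
      field_simp
    rw [hww, hvw]
    -- The case `γ = 0` is Gibbs' inequality: strictness comes from the means if the variances
    -- agree, and otherwise from `log t < t - 1` at `t = w / v`.
    by_cases hvw' : v = w
    · subst hvw'
      have hμ : ν - μ ≠ 0 := fun h => hne (by rw [sub_eq_zero.1 h])
      have : 0 < (ν - μ) ^ 2 / (2 * v) := by positivity
      have : v / v = 1 := div_self hv.ne'
      linarith
    · have h3 := Real.log_lt_sub_one_of_pos (div_pos hw hv)
        (fun h => hvw' (by field_simp at h; exact h.symm))
      rw [Real.log_div hw.ne' hv.ne'] at h3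
      have : 0 ≤ (ν - μ) ^ 2 / (2 * v) := by positivity
      linarith
  · rw [integral_likForm_pos hγ hv hw, integral_likForm_pos hγ hw hw]
    have hkγ : 0 < k / γ := div_pos hk hγ
    have hW : ∀ u : ℝ, 0 < u → 0 < varWeight γ u * (√(1 + γ * w / u))⁻¹ := fun u hu => by
      have := varWeight_pos hu γ
      positivity
    have hexp : Real.exp (-(γ * (ν - ν) ^ 2 / (2 * (w + γ * w)))) = 1 := by simp
    rw [hexp, mul_one]
    -- With equal variances the exponential in the mean error is strictly below `1`; otherwise it is
    -- bounded by `1` and the variance profile gives strictness.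
    by_cases hvw' : v = w
    · subst hvw'
      have hμ : ν - μ ≠ 0 := fun h => hne (by rw [sub_eq_zero.1 h])
      refine mul_lt_of_lt_one_right (mul_pos hkγ (hW v hv)) ?_
      rw [Real.exp_lt_one_iff]
      have : 0 < γ * (ν - μ) ^ 2 / (2 * (v + γ * v)) := by positivity
      linarith
    · refine (mul_le_of_le_one_right (mul_pos hkγ (hW v hv)).le ?_).trans_lt
        (mul_lt_mul_of_pos_left (varWeight_mul_lt hγ hv hw hvw') hkγ)
      rw [Real.exp_le_one_iff]
      have : 0 ≤ γ * (ν - μ) ^ 2 / (2 * (v + γ * w)) := by positivity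
      linarith

/-- At the truth the tilted law is `N(0, 1/(1+γ))`, so `1 - γ r²` has mean `1/(1+γ)`; the mass of
the tilt supplies the further factor `(1+γ)^(-1/2)`. -/
theorem integral_curvForm {γ v : ℝ} (hγ : 0 ≤ γ) (hv : 0 < v) (k μ : ℝ) :
    ∫ r, curvForm k γ μ v (μ + √v * r) ∂gaussianReal 0 1
      = k * varWeight γ v * v⁻¹ * ((√(1 + γ))⁻¹ * (1 + γ)⁻¹) := by
  have h : ∀ r : ℝ, curvForm k γ μ v (μ + √v * r) = k * varWeight γ v * v⁻¹
      * ((1 - γ * r ^ 2) * Real.exp (-(γ * (0 + √v * r) ^ 2 / (2 * v)))) := fun r => by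
    have : (μ + √v * r - μ) ^ 2 = v * r ^ 2 := by
      rw [add_sub_cancel_left, mul_pow, Real.sq_sqrt hv.le]
    rw [curvForm, this, zero_add, mul_pow, Real.sq_sqrt hv.le, mul_div_cancel_left₀ _ hv.ne']
  simp_rw [h]
  rw [integral_const_mul, integral_mul_exp_gaussianReal hγ hv, Real.sq_sqrt hv.le,
    mul_div_cancel_right₀ _ hv.ne']
  have hγ1 : 0 < 1 + γ := by linarith
  congr 1
  simp only [mul_zero, zero_mul, zero_div, neg_zero, ne_eq, OfNat.ofNat_ne_zero,
    not_false_eq_true, zero_pow, Real.exp_zero, mul_one]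
  rw [integral_sub (integrable_const _) ((integrable_sq_gaussianReal _).const_mul _),
    integral_const_mul, integral_sq_gaussianReal, Real.coe_toNNReal _ (inv_pos.2 hγ1).le]
  congr 1
  simp
  field_simp
  ring

/-- In logarithms, with `L = log (2πv)`, the worst admissible `k` requires `γ(log (1+γ) -
L)/(2(1+γ)) < (3/2) log (1+γ)`. To first order as `γ → 0` this reads `L > -3`, which is the origin
of the threshold `e⁻³/(2π)`. -/
theorem integral_curvForm_lt {k γ v : ℝ} (hk : 0 < k) (hk' : k ≤ (1 + γ) ^ (γ / (2 * (1 + γ))))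
    (hγ : 0 < γ) (hv : 0 < v) (hv3 : (2 * Real.pi)⁻¹ * Real.exp (-3) < v) (μ : ℝ) :
    ∫ r, curvForm k γ μ v (μ + √v * r) ∂gaussianReal 0 1 < v⁻¹ := by
  rw [integral_curvForm hγ.le hv]
  have hγ1 : 0 < 1 + γ := by linarith
  have hlog : -3 < Real.log (2 * Real.pi * v) := by
    rw [Real.lt_log_iff_exp_lt (by positivity)]
    rwa [inv_mul_lt_iff₀ (by positivity)] at hv3
  have hW := varWeight_pos hv γ
  have hs := Real.sqrt_pos.2 hγ1
  have hlk : Real.log k ≤ γ / (2 * (1 + γ)) * Real.log (1 + γ) := by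
    rw [← Real.log_rpow hγ1]; exact Real.log_le_log hk hk'
  have hl1 := Real.le_log_one_add_of_nonneg hγ.le
  suffices h : k * varWeight γ v * ((√(1 + γ))⁻¹ * (1 + γ)⁻¹) < 1 by
    calc _ = k * varWeight γ v * ((√(1 + γ))⁻¹ * (1 + γ)⁻¹) * v⁻¹ := by ring
      _ < 1 * v⁻¹ := mul_lt_mul_of_pos_right h (inv_pos.2 hv)
      _ = v⁻¹ := one_mul _
  rw [← Real.log_neg_iff (by positivity), Real.log_mul (by positivity) (by positivity),
    Real.log_mul hk.ne' hW.ne', Real.log_mul (by positivity) (by positivity), Real.log_inv,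
    Real.log_inv, Real.log_sqrt hγ1.le, varWeight, Real.log_rpow (by positivity)]
  set l := Real.log (1 + γ)
  set L := Real.log (2 * Real.pi * v)
  have hq : 0 < γ / (2 * (1 + γ)) := by positivity
  have h3 : -(γ / (2 * (1 + γ))) * L < γ / (2 * (1 + γ)) * 3 := by nlinarith
  -- Clearing denominators leaves `3γ ≤ (3 + 2γ) log (1+γ)`, which follows from `log (1+γ) ≥
  -- 2γ/(γ+2)`.
  have h4 : γ / (2 * (1 + γ)) * 3 ≤ (3 / 2 - γ / (2 * (1 + γ))) * l := by
    have e : 3 / 2 - γ / (2 * (1 + γ)) = (3 + 2 * γ) / (2 * (1 + γ)) := by field_simp; ring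
    have e' : γ / (2 * (1 + γ)) * 3 = 3 * γ / (2 * (1 + γ)) := by ring
    rw [e, e', div_mul_eq_mul_div]
    refine div_le_div_of_nonneg_right ?_ (by positivity)
    have : 3 * γ ≤ (3 + 2 * γ) * (2 * γ / (γ + 2)) := by
      rw [mul_div_assoc', le_div_iff₀ (by positivity)]; nlinarith [sq_nonneg γ]
    exact this.trans (mul_le_mul_of_nonneg_left hl1 (by positivity))
  linarith

end FayHerriot

/-! ### Joint law of the two-stage model in terms of standard normal errors. -/

namespace FayHerriot

theorem gaussianReal_map_standardize (m : ℝ) {v : ℝ} (hv : 0 < v) :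
    (gaussianReal m v.toNNReal).map (fun y => (y - m) / √v) = gaussianReal 0 1 := by
  have : (fun y : ℝ => (y - m) / √v) = (fun y => y / √v) ∘ (fun y => y - m) := rfl
  rw [this, ← Measure.map_map (by fun_prop) (by fun_prop), gaussianReal_map_sub_const,
    gaussianReal_map_div_const]
  congr 1
  · simp
  · ext
    simp [Real.sq_sqrt hv.le, Real.coe_toNNReal _ hv.le, hv.ne']

theorem gaussianReal_prod_map_rotate {a b : ℝ} (hab : a ^ 2 + b ^ 2 = 1) :
    ((gaussianReal 0 1).prod (gaussianReal 0 1)).map (fun q : ℝ × ℝ => a * q.1 + b * q.2)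
      = gaussianReal 0 1 := by
  have : (fun q : ℝ × ℝ => a * q.1 + b * q.2)
      = (fun q : ℝ × ℝ => q.1 + q.2) ∘ Prod.map (fun u => a * u) (fun w => b * w) := rfl
  rw [this, ← Measure.map_map (by fun_prop) (by fun_prop),
    ← Measure.map_prod_map _ _ (by fun_prop) (by fun_prop), gaussianReal_map_const_mul,
    gaussianReal_map_const_mul]
  have h := gaussianReal_conv_gaussianReal (m₁ := a * 0) (m₂ := b * 0)
    (v₁ := NNReal.mk (a ^ 2) (sq_nonneg _) * 1) (v₂ := NNReal.mk (b ^ 2) (sq_nonneg _) * 1)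
  rw [Measure.conv] at h
  refine h.trans ?_
  congr 1
  · simp
  · ext; simpa using hab

variable {Ω E : Type*} [MeasurableSpace Ω] [MeasurableSpace E]

/-- If `Y` is conditionally `N(m(Z), v(Z))` given `Z`, then the standardized `Y` is standard normal
and independent of `Z`. -/
theorem map_standardize (P : Measure Ω) [IsProbabilityMeasure P] {Z : Ω → E} {Y : Ω → ℝ}
    (hZ : Measurable Z) (hY : Measurable Y) {m v : E → ℝ} (hm : Measurable m) (hv : Measurable v)
    (hpos : ∀ᵐ z ∂(P.map Z), 0 < v z)
    (h : ∀ᵐ z ∂(P.map Z), condDistrib Y Z P z = gaussianReal (m z) (v z).toNNReal) :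
    P.map (fun ω => (Z ω, (Y ω - m (Z ω)) / √(v (Z ω)))) = (P.map Z).prod (gaussianReal 0 1) := by
  have : IsProbabilityMeasure (P.map Z) := Measure.isProbabilityMeasure_map hZ.aemeasurable
  have hT : Measurable (fun q : E × ℝ => (q.1, (q.2 - m q.1) / √(v q.1))) := by fun_prop
  have e : (fun ω => (Z ω, (Y ω - m (Z ω)) / √(v (Z ω))))
      = (fun q : E × ℝ => (q.1, (q.2 - m q.1) / √(v q.1))) ∘ (fun ω => (Z ω, Y ω)) := rfl
  rw [e, ← Measure.map_map hT (by fun_prop), ← compProd_map_condDistrib hY.aemeasurable]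
  -- Disintegrate over `Z`: almost every fibre is a normal law which the standardization sends to
  -- the same `N(0, 1)`, hence a product measure.
  ext s hs
  rw [Measure.map_apply hT hs, Measure.compProd_apply (hT hs), Measure.prod_apply hs]
  refine lintegral_congr_ae ?_
  filter_upwards [hpos, h] with z hz hz'
  rw [hz', ← gaussianReal_map_standardize (m z) hz,
    Measure.map_apply (by fun_prop) (measurable_prodMk_left hs)]
  rfl

/-- A rotation, possibly depending on an independent variable, of two independent standard normal
variables. -/
theorem map_rotate (Q : Measure E) [IsProbabilityMeasure Q] {a b : E → ℝ} (ha : Measurable a)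
    (hb : Measurable b) (hab : ∀ᵐ z ∂Q, a z ^ 2 + b z ^ 2 = 1) :
    ((Q.prod (gaussianReal 0 1)).prod (gaussianReal 0 1)).map
      (fun q : (E × ℝ) × ℝ => (q.1.1, a q.1.1 * q.1.2 + b q.1.1 * q.2))
      = Q.prod (gaussianReal 0 1) := by
  have hT : Measurable
      (fun q : (E × ℝ) × ℝ => (q.1.1, a q.1.1 * q.1.2 + b q.1.1 * q.2)) := by fun_prop
  ext s hs
  rw [Measure.map_apply hT hs, Measure.prod_apply (hT hs),
    lintegral_prod _ (measurable_measure_prodMk_left (hT hs)).aemeasurable, Measure.prod_apply hs]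
  refine lintegral_congr_ae ?_
  filter_upwards [hab] with z hz
  have hR : Measurable (fun q : ℝ × ℝ => a z * q.1 + b z * q.2) := by fun_prop
  have h := congrArg (fun ν : Measure ℝ => ν (Prod.mk z ⁻¹' s)) (gaussianReal_prod_map_rotate hz)
  simp only [Measure.map_apply hR (measurable_prodMk_left hs),
    Measure.prod_apply (hR (measurable_prodMk_left hs))] at h
  exact h

variable {p : ℕ} {P : Measure Ω} [IsProbabilityMeasure P] {β : Cov p} {A : ℝ} {x : Ω → Cov p}
  {D θ y : Ω → ℝ}

/-- In the two-stage model the two standardized errors are independent standard normal variables,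
independent of `(x, D)`. -/
theorem IsModel.map_errors (h : IsModel P β A x D θ y) (hA : 0 < A) (hx : Measurable x)
    (hD : Measurable D) (hθ : Measurable θ) (hy : Measurable y) (hDpos : ∀ᵐ ω ∂P, 0 < D ω) :
    P.map (fun ω => (((x ω, D ω), (θ ω - inner ℝ (x ω) β) / √A), (y ω - θ ω) / √(D ω)))
      = ((P.map (fun ω => (x ω, D ω))).prod (gaussianReal 0 1)).prod (gaussianReal 0 1) := by
  have hx1 : Measurable fun z : Cov p × ℝ => inner ℝ z.1 β :=
    (Measurable.inner_const measurable_fst)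
  have h1 := map_standardize P (Z := fun ω => (x ω, D ω)) (hx.prodMk hD) hθ
    (m := fun z => inner ℝ z.1 β) (v := fun _ => A) hx1
    measurable_const (ae_of_all _ fun _ => hA) h.area_level
  have h2 := map_standardize P (Z := fun ω => (x ω, D ω, θ ω)) (hx.prodMk (hD.prodMk hθ)) hy
    (m := fun z => z.2.2) (v := fun z => z.2.1) (by fun_prop) (by fun_prop)
    ((ae_map_iff (by fun_prop)
      (measurableSet_lt measurable_const (by fun_prop))).2 hDpos) h.sampling_level
  have hT : Measurable (fun z : Cov p × ℝ × ℝ =>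
      ((z.1, z.2.1), (z.2.2 - inner ℝ z.1 β) / √A)) := by
    have : Measurable fun z : Cov p × ℝ × ℝ => inner ℝ z.1 β :=
      Measurable.inner_const measurable_fst
    fun_prop
  have e : (fun ω => (((x ω, D ω), (θ ω - inner ℝ (x ω) β) / √A), (y ω - θ ω) / √(D ω)))
      = Prod.map (fun z : Cov p × ℝ × ℝ => ((z.1, z.2.1), (z.2.2 - inner ℝ z.1 β) / √A)) id
        ∘ (fun ω => ((x ω, D ω, θ ω), (y ω - θ ω) / √(D ω))) := rfl
  have : IsProbabilityMeasure (P.map fun ω => (x ω, D ω, θ ω)) :=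
    Measure.isProbabilityMeasure_map (by fun_prop)
  rw [e, ← Measure.map_map (hT.prodMap measurable_id) (by fun_prop), h2,
    ← Measure.map_prod_map _ _ hT measurable_id, Measure.map_map hT (by fun_prop),
    Measure.map_id, ← h1]
  rfl

/-- The coefficients may depend on `D` because both errors are independent of `(x, D)`. One rotation
yields the marginal law of `y`, the orthogonal one the posterior error. -/
theorem IsModel.map_rotated_errors (h : IsModel P β A x D θ y) (hA : 0 < A) (hx : Measurable x)
    (hD : Measurable D) (hθ : Measurable θ) (hy : Measurable y) (hDpos : ∀ᵐ ω ∂P, 0 < D ω)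
    {a b : ℝ → ℝ} (ha : Measurable a) (hb : Measurable b)
    (hab : ∀ d, 0 < d → a d ^ 2 + b d ^ 2 = 1) :
    P.map (fun ω => ((x ω, D ω),
        a (D ω) * ((θ ω - inner ℝ (x ω) β) / √A) + b (D ω) * ((y ω - θ ω) / √(D ω))))
      = (P.map (fun ω => (x ω, D ω))).prod (gaussianReal 0 1) := by
  have : IsProbabilityMeasure (P.map fun ω => (x ω, D ω)) :=
    Measure.isProbabilityMeasure_map (by fun_prop)
  have hin : Measurable fun ω => inner ℝ (x ω) β := hx.inner_const
  have hab' : ∀ᵐ z ∂(P.map fun ω => (x ω, D ω)), 0 < z.2 :=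
    (ae_map_iff (by fun_prop) (measurableSet_lt measurable_const (by fun_prop))).2 hDpos
  rw [← map_rotate (P.map fun ω => (x ω, D ω)) (a := fun z => a z.2) (b := fun z => b z.2)
    (by fun_prop) (by fun_prop) (by filter_upwards [hab'] with z hz using hab _ hz),
    ← h.map_errors hA hx hD hθ hy hDpos, Measure.map_map (by fun_prop) (by fun_prop)]
  rfl

/-- Marginally over `θ`, the standardized observation is standard normal and independent of
`(x, D)`. -/
theorem IsModel.map_obs (h : IsModel P β A x D θ y) (hA : 0 < A) (hx : Measurable x)
    (hD : Measurable D) (hθ : Measurable θ) (hy : Measurable y) (hDpos : ∀ᵐ ω ∂P, 0 < D ω) :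
    P.map (fun ω => ((x ω, D ω), (y ω - inner ℝ (x ω) β) / √(A + D ω)))
      = (P.map (fun ω => (x ω, D ω))).prod (gaussianReal 0 1) := by
  -- With standardized errors `u` and `w`, `y - xᵀβ = √A u + √D w`; dividing by `√(A + D)` gives
  -- unit coefficients in square sum.
  rw [← h.map_rotated_errors hA hx hD hθ hy hDpos (a := fun d => √A / √(A + d))
    (b := fun d => √d / √(A + d)) (by fun_prop) (by fun_prop)]
  · refine Measure.map_congr ?_
    filter_upwards [hDpos] with ω hω
    have h1 : √A ≠ 0 := (Real.sqrt_pos.2 hA).ne'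
    have h2 : √(D ω) ≠ 0 := (Real.sqrt_pos.2 hω).ne'
    have h3 : √(A + D ω) ≠ 0 := (Real.sqrt_pos.2 (by linarith)).ne'
    congr 1
    field_simp
    ring
  · intro d hd
    rw [div_pow, div_pow, Real.sq_sqrt hA.le, Real.sq_sqrt hd.le, Real.sq_sqrt (by linarith),
      ← add_div, div_self (by linarith)]

/-- The standardized posterior error at the true parameter is standard normal. -/
theorem IsModel.map_posterior (h : IsModel P β A x D θ y) (hA : 0 < A) (hx : Measurable x)
    (hD : Measurable D) (hθ : Measurable θ) (hy : Measurable y) (hDpos : ∀ᵐ ω ∂P, 0 < D ω) :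
    P.map (fun ω => (θ ω - (y ω - D ω * ((y ω - inner ℝ (x ω) β) / (A + D ω))))
        / √(D ω - D ω ^ 2 / (A + D ω)))
      = gaussianReal 0 1 := by
  have hin : Measurable fun ω => inner ℝ (x ω) β := hx.inner_const
  have : IsProbabilityMeasure (P.map fun ω => (x ω, D ω)) :=
    Measure.isProbabilityMeasure_map (by fun_prop)
  -- The posterior error is `(D(θ - xᵀβ) - A(y - θ))/(A + D)` and its scale is `√(AD/(A + D))`, so
  -- the quotient is `(√D u - √A w)/√(A + D)`.
  have h0 := congrArg (Measure.map Prod.snd)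
    (h.map_rotated_errors hA hx hD hθ hy hDpos (a := fun d => √d / √(A + d))
    (b := fun d => -(√A / √(A + d))) (by fun_prop) (by fun_prop) (by
      intro d hd
      rw [neg_sq, div_pow, div_pow, Real.sq_sqrt hA.le, Real.sq_sqrt hd.le,
        Real.sq_sqrt (by linarith), ← add_div, add_comm d, div_self (by linarith)]))
  rw [Measure.map_map (by fun_prop) (by fun_prop), Measure.map_snd_prod] at h0
  simp only [measure_univ, one_smul] at h0
  rw [← h0]
  refine Measure.map_congr ?_
  filter_upwards [hDpos] with ω hω
  have hv : 0 < A + D ω := by linarith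
  have h1 : 0 < √A := Real.sqrt_pos.2 hA
  have h2 : 0 < √(D ω) := Real.sqrt_pos.2 hω
  have h3 : 0 < √(A + D ω) := Real.sqrt_pos.2 hv
  have e : D ω - D ω ^ 2 / (A + D ω) = A * D ω / (A + D ω) := by field_simp; ring
  have q1 : √A ^ 2 = A := Real.sq_sqrt hA.le
  have q2 : √(D ω) ^ 2 = D ω := Real.sq_sqrt hω.le
  have q3 : √(A + D ω) ^ 2 = A + D ω := Real.sq_sqrt hv.le
  rw [e, Real.sqrt_div' _ hv.le, Real.sqrt_mul hA.le]
  simp only [Function.comp]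
  have e2 : θ ω - (y ω - D ω * ((y ω - inner ℝ (x ω) β) / (A + D ω)))
      = (√(D ω) ^ 2 * (θ ω - inner ℝ (x ω) β) - √A ^ 2 * (y ω - θ ω)) / √(A + D ω) ^ 2 := by
    rw [q1, q2, q3]; field_simp; ring
  rw [e2]
  field_simp
  ring

end FayHerriot

/-! ### General tools: uniform strong law, argmax convergence, normal quantiles. -/

namespace FayHerriot

/-- Uniform strong law of large numbers over a compact parameter space. -/
theorem uniform_strong_law {Ω E K : Type*} [MeasurableSpace Ω] {P : Measure Ω}
    [IsProbabilityMeasure P] [TopologicalSpace E] [MeasurableSpace E]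
    [OpensMeasurableSpace E] [SecondCountableTopology E] [TopologicalSpace K]
    [CompactSpace K] (F : C(E × K, ℝ)) {Z : ℕ → Ω → E} (hZ : ∀ i, Measurable (Z i))
    (hindep : Pairwise fun i j => IndepFun (Z i) (Z j) P)
    (hident : ∀ i, IdentDistrib (Z i) (Z 0) P P) {b : Ω → ℝ} (hb : Integrable b P)
    (hbound : ∀ᵐ ω ∂P, ∀ t, |F (Z 0 ω, t)| ≤ b ω) :
    (Continuous fun t => ∫ ω, F (Z 0 ω, t) ∂P) ∧
    ∀ᵐ ω ∂P, TendstoUniformly (fun (m : ℕ) t => (m : ℝ)⁻¹ * ∑ j ∈ Finset.range m, F (Z j ω, t))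
      (fun t => ∫ ω, F (Z 0 ω, t) ∂P) atTop := by
  -- Each observation is viewed as a random element of the Banach space `C(K, ℝ)`; the Banach-valued
  -- strong law in sup norm is the uniform law.
  let _ : MeasurableSpace C(K, ℝ) := borel _
  have : BorelSpace C(K, ℝ) := ⟨rfl⟩
  have hg : Measurable F.curry := F.curry.continuous.measurable
  have hint : Integrable (F.curry ∘ Z 0) P := by
    refine Integrable.mono' (g := fun ω => |b ω|) hb.abs ?_ ?_
    · exact (F.curry.continuous.stronglyMeasurable.comp_measurable (hZ 0)).aestronglyMeasurable
    · filter_upwards [hbound] with ω hω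
      exact (ContinuousMap.norm_le _ (abs_nonneg _)).2 fun t => (hω t).trans (le_abs_self _)
  have hev : ∀ t, (∫ ω, (F.curry ∘ Z 0) ω ∂P) t = ∫ ω, F (Z 0 ω, t) ∂P := fun t => by
    have := (ContinuousMap.evalCLM ℝ t).integral_comp_comm hint
    exact this.symm
  have hlim := strong_law_ae (fun i => F.curry ∘ Z i) hint
    (fun i j hij => (hindep hij).comp hg hg) (fun i => (hident i).comp hg)
  have hfun : (fun t => ∫ ω, F (Z 0 ω, t) ∂P) = ⇑(∫ ω, (F.curry ∘ Z 0) ω ∂P) :=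
    funext fun t => (hev t).symm
  refine ⟨by rw [hfun]; exact ContinuousMap.continuous _, ?_⟩
  filter_upwards [hlim] with ω hω
  rw [ContinuousMap.tendsto_iff_tendstoUniformly] at hω
  rw [hfun]
  convert hω using 3 with m t
  simp

/-- Maximizers of uniformly convergent criteria on a compact space converge to the unique
maximizer of the limit. -/
theorem tendsto_argmax {K : Type*} [TopologicalSpace K] [CompactSpace K] {M : ℕ → K → ℝ}
    {L : K → ℝ} (hL : Continuous L) (hM : TendstoUniformly M L atTop) {t₀ : K}
    (ht₀ : ∀ t, t ≠ t₀ → L t < L t₀) {s : ℕ → K} (hs : ∀ m t, M m t ≤ M m (s m)) :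
    Tendsto s atTop (𝓝 t₀) := by
  rw [tendsto_nhds]
  intro U hU hmem
  rcases (Uᶜ).eq_empty_or_nonempty with he | hne
  · rw [Set.compl_empty_iff] at he
    simp [he]
  obtain ⟨t₁, ht₁, hmax⟩ := (hU.isClosed_compl.isCompact).exists_isMaxOn hne hL.continuousOn
  have hlt : L t₁ < L t₀ := ht₀ t₁ fun h => ht₁ (h ▸ hmem)
  -- With half the gap as tolerance, values outside `U` stay below the midpoint of `L t₁` and `L
  -- t₀`, while the value at `t₀` lies above it.
  have hε : 0 < (L t₀ - L t₁) / 2 := by linarith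
  filter_upwards [Metric.tendstoUniformly_iff.1 hM _ hε] with m hm
  by_contra hout
  have h1 : L (s m) ≤ L t₁ := hmax hout
  have h2 := hm (s m)
  have h3 := hm t₀
  have h4 := hs m t₀
  rw [Real.dist_eq, abs_lt] at h2 h3
  linarith [h2.1, h3.2]

/-- Two-sided form of the upper quantile of the standard normal distribution. -/
theorem gaussianReal_Ioo_upperQuantile {α : ℝ} (hα0 : 0 < α) (hα1 : α < 1) :
    (gaussianReal 0 1).real (Set.Ioo (-upperQuantile (α / 2)) (upperQuantile (α / 2))) = 1 - α := by
  have := nullSingletonClass_gaussianReal (μ := 0) (v := 1) one_ne_zero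
  set N := gaussianReal 0 1
  set z := upperQuantile (α / 2) with hz
  -- A jump of the distribution function would be an atom. Continuity makes the infimum defining the
  -- quantile attain the level exactly.
  have hcont : Continuous (cdf N) := by
    rw [continuous_iff_continuousAt]
    intro t
    rw [(cdf N).mono.continuousAt_iff_leftLim_eq_rightLim, StieltjesFunction.rightLim_eq]
    have h := (cdf N).measure_singleton t
    rw [measure_cdf, measure_singleton, eq_comm, ENNReal.ofReal_eq_zero] at h
    exact le_antisymm ((cdf N).mono.leftLim_le le_rfl) (by linarith)
  have hbelow : ∃ t₀, cdf N t₀ < 1 - α / 2 :=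
    ((tendsto_cdf_atBot N).eventually_lt_const (by linarith : (0 : ℝ) < 1 - α / 2)).exists
  have habove : ∃ t₁, 1 - α / 2 < cdf N t₁ :=
    ((tendsto_cdf_atTop N).eventually_const_lt (by linarith : 1 - α / 2 < (1 : ℝ))).exists
  obtain ⟨t₀, ht₀⟩ := hbelow
  obtain ⟨t₁, ht₁⟩ := habove
  have hbdd : BddBelow {t : ℝ | 1 - α / 2 ≤ cdf N t} :=
    ⟨t₀, fun t ht => ((monotone_cdf N).reflect_lt (ht₀.trans_le ht)).le⟩
  have hcdf : cdf N z = 1 - α / 2 := by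
    refine le_antisymm ?_ ?_
    · have hlt : ∀ᶠ t in 𝓝[<] z, cdf N t ≤ 1 - α / 2 := by
        filter_upwards [self_mem_nhdsWithin] with t ht
        by_contra hcon
        exact absurd (csInf_le hbdd (le_of_not_ge hcon)) (not_le.2 ht)
      exact le_of_tendsto (hcont.continuousAt.mono_left nhdsWithin_le_nhds) hlt
    · exact (isClosed_le continuous_const hcont).csInf_mem ⟨t₁, ht₁.le⟩ hbdd
  have hIic : N.real (Set.Iic z) = 1 - α / 2 := by rw [← cdf_eq_real, hcdf]
  have hIic' : N.real (Set.Iic (-z)) = α / 2 := by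
    have hneg : N.map (fun t => -t) = N := by simpa using gaussianReal_map_neg (μ := 0) (v := 1)
    calc N.real (Set.Iic (-z)) = N.real (Set.Ici z) := by
          conv_lhs => rw [← hneg]
          rw [map_measureReal_apply measurable_neg measurableSet_Iic]
          congr 1; ext t; simp
      _ = N.real (Set.Ioi z) := measureReal_congr Ioi_ae_eq_Ici.symm
      _ = α / 2 := by
          rw [← Set.compl_Iic, probReal_compl_eq_one_sub measurableSet_Iic, hIic]; ring
  have hzz : -z ≤ z := by
    refine ((monotone_cdf N).reflect_lt ?_).le
    rw [cdf_eq_real, hIic', hcdf]; linarith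
  have hdiff : Set.Ioc (-z) z = Set.Iic z \ Set.Iic (-z) := by
    ext t; simp [and_comm]
  rw [measureReal_congr Ioo_ae_eq_Ioc, hdiff,
    measureReal_sdiff (Set.Iic_subset_Iic.2 hzz) measurableSet_Iic, hIic, hIic']
  ring

end FayHerriot

/-! ### Continuity, integrable envelopes, identifiability and the population inequalities. -/

namespace FayHerriot

theorem continuous_varWeight {T : Type*} [TopologicalSpace T] {v : T → ℝ} (hv : Continuous v)
    (hpos : ∀ t, 0 < v t) (γ : ℝ) : Continuous fun t => varWeight γ (v t) := by
  unfold varWeight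
  exact (continuous_const.mul hv).rpow_const fun t =>
    Or.inl (mul_pos (by positivity) (hpos t)).ne'

theorem continuous_likForm {T : Type*} [TopologicalSpace T] {μ v y : T → ℝ} (hμ : Continuous μ)
    (hv : Continuous v) (hy : Continuous y) (hpos : ∀ t, 0 < v t) (k γ : ℝ) :
    Continuous fun t => likForm k γ (μ t) (v t) (y t) := by
  have hW := continuous_varWeight hv hpos γ
  have h0 : ∀ t, 2 * v t ≠ 0 := fun t => (mul_pos two_pos (hpos t)).ne'
  by_cases h : γ = 0
  · have h1 : Continuous fun t => Real.log (2 * Real.pi * v t) :=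
      (continuous_const.mul hv).log fun t => (mul_pos (by positivity) (hpos t)).ne'
    have h2 : Continuous fun t => (y t - μ t) ^ 2 / (2 * v t) :=
      ((hy.sub hμ).pow 2).div (continuous_const.mul hv) h0
    simp only [likForm, h, if_true]
    fun_prop
  · have h2 : Continuous fun t => γ * (y t - μ t) ^ 2 / (2 * v t) :=
      (continuous_const.mul ((hy.sub hμ).pow 2)).div (continuous_const.mul hv) h0
    simp only [likForm, h, if_false]
    fun_prop

theorem continuous_curvForm {T : Type*} [TopologicalSpace T] {μ v y : T → ℝ} (hμ : Continuous μ)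
    (hv : Continuous v) (hy : Continuous y) (hpos : ∀ t, 0 < v t) (k γ : ℝ) :
    Continuous fun t => curvForm k γ (μ t) (v t) (y t) := by
  have hW := continuous_varWeight hv hpos γ
  have h0 : ∀ t, 2 * v t ≠ 0 := fun t => (mul_pos two_pos (hpos t)).ne'
  have h1 : Continuous fun t => (v t)⁻¹ := hv.inv₀ fun t => (hpos t).ne'
  have h2 : Continuous fun t => γ * (y t - μ t) ^ 2 / (2 * v t) :=
    (continuous_const.mul ((hy.sub hμ).pow 2)).div (continuous_const.mul hv) h0
  have h3 : Continuous fun t => (y t - μ t) ^ 2 / v t :=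
    ((hy.sub hμ).pow 2).div hv fun t => (hpos t).ne'
  unfold curvForm
  fun_prop

theorem varWeight_le {γ v₀ v : ℝ} (hγ : 0 ≤ γ) (hv₀ : 0 < v₀) (hv : v₀ ≤ v) :
    varWeight γ v ≤ varWeight γ v₀ := by
  refine Real.rpow_le_rpow_of_nonpos (by positivity) (by gcongr) ?_
  have : 0 ≤ γ / (2 * (1 + γ)) := by positivity
  linarith

theorem sq_sub_div_le {v₀ v μ B y : ℝ} (hv₀ : 0 < v₀) (hv : v₀ ≤ v) (hμ : |μ| ≤ B) :
    (y - μ) ^ 2 / v ≤ 2 * (1 + B ^ 2) / v₀ * (1 + y ^ 2) := by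
  have hB : μ ^ 2 ≤ B ^ 2 := by rw [← sq_abs]; gcongr
  calc (y - μ) ^ 2 / v ≤ (y - μ) ^ 2 / v₀ := by gcongr
    _ ≤ (2 * (1 + B ^ 2) * (1 + y ^ 2)) / v₀ := by
        gcongr
        nlinarith [sq_nonneg (y + μ), mul_nonneg (sq_nonneg B) (sq_nonneg y)]
    _ = _ := by ring

/-- The envelope is uniform in the parameters and integrable because `y` has a second moment. The
upper bound `V` is needed only for the logarithm at `γ = 0`. -/
theorem exists_likForm_bound {k γ v₀ : ℝ} (hk : 0 < k) (hγ : 0 ≤ γ) (hv₀ : 0 < v₀) (V B : ℝ) :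
    ∃ C, ∀ μ v y, v₀ ≤ v → v ≤ V → |μ| ≤ B → |likForm k γ μ v y| ≤ C * (1 + y ^ 2) := by
  rcases hγ.eq_or_lt with rfl | hγ
  · refine ⟨|Real.log (2 * Real.pi * v₀)| + |Real.log (2 * Real.pi * V)| + 2 * (1 + B ^ 2) / v₀,
      fun μ v y h1 h2 h3 => ?_⟩
    have hv : 0 < v := hv₀.trans_le h1
    have hq := sq_sub_div_le (y := y) hv₀ h1 h3
    have hq0 : 0 ≤ (y - μ) ^ 2 / v := by positivity
    have e : (y - μ) ^ 2 / (2 * v) = (y - μ) ^ 2 / v / 2 := by field_simp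
    have l1 : Real.log (2 * Real.pi * v₀) ≤ Real.log (2 * Real.pi * v) :=
      Real.log_le_log (by positivity) (by gcongr)
    have l2 : Real.log (2 * Real.pi * v) ≤ Real.log (2 * Real.pi * V) :=
      Real.log_le_log (by positivity) (by gcongr)
    have hl : |Real.log (2 * Real.pi * v)|
        ≤ |Real.log (2 * Real.pi * v₀)| + |Real.log (2 * Real.pi * V)| := by
      rw [abs_le]
      constructor
      · linarith [neg_abs_le (Real.log (2 * Real.pi * v₀)), abs_nonneg (Real.log (2 * Real.pi * V))]
      · linarith [le_abs_self (Real.log (2 * Real.pi * V)),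
          abs_nonneg (Real.log (2 * Real.pi * v₀))]
    have hy : 0 ≤ y ^ 2 := sq_nonneg y
    simp only [likForm, if_true, e]
    set S := |Real.log (2 * Real.pi * v₀)| + |Real.log (2 * Real.pi * V)| with hS
    have hS0 : 0 ≤ S := by positivity
    have hSy : 0 ≤ S * y ^ 2 := by positivity
    rw [abs_le] at hl ⊢
    constructor <;> nlinarith [hl.1, hl.2]
  · refine ⟨k / γ * varWeight γ v₀, fun μ v y h1 h2 h3 => ?_⟩
    have hv : 0 < v := hv₀.trans_le h1
    have hW := varWeight_pos hv γ
    have hW0 := varWeight_pos hv₀ γ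
    simp only [likForm, hγ.ne', if_false]
    rw [abs_of_nonneg (by positivity)]
    have he : Real.exp (-(γ * (y - μ) ^ 2 / (2 * v))) ≤ 1 := by
      rw [Real.exp_le_one_iff, neg_nonpos]; positivity
    have := varWeight_le hγ.le hv₀ h1
    gcongr
    nlinarith [sq_nonneg y]

theorem exists_curvForm_bound {k γ v₀ : ℝ} (hk : 0 < k) (hγ : 0 ≤ γ) (hv₀ : 0 < v₀) (B : ℝ) :
    ∃ C, 0 ≤ C ∧ ∀ μ v y, v₀ ≤ v → |μ| ≤ B → |curvForm k γ μ v y| ≤ C * (1 + y ^ 2) := by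
  have hW0 := varWeight_pos hv₀ γ
  refine ⟨k * varWeight γ v₀ * v₀⁻¹ * (1 + γ * (2 * (1 + B ^ 2) / v₀)), by positivity,
    fun μ v y h1 h3 => ?_⟩
  have hv : 0 < v := hv₀.trans_le h1
  have hW := varWeight_pos hv γ
  have he : Real.exp (-(γ * (y - μ) ^ 2 / (2 * v))) ≤ 1 := by
    rw [Real.exp_le_one_iff, neg_nonpos]; positivity
  have hWle := varWeight_le hγ hv₀ h1
  have hq := sq_sub_div_le (y := y) hv₀ h1 h3
  have hq0 : 0 ≤ (y - μ) ^ 2 / v := by positivity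
  have habs : |1 - γ * ((y - μ) ^ 2 / v)| ≤ (1 + γ * (2 * (1 + B ^ 2) / v₀)) * (1 + y ^ 2) := by
    have h4 : γ * ((y - μ) ^ 2 / v) ≤ γ * (2 * (1 + B ^ 2) / v₀ * (1 + y ^ 2)) := by gcongr
    have h5 : 0 ≤ γ * ((y - μ) ^ 2 / v) := by positivity
    rw [abs_le]; constructor <;> nlinarith [sq_nonneg y]
  rw [curvForm, abs_mul, abs_mul (1 - _), abs_of_nonneg (by positivity : 0 ≤ k * varWeight γ v * v⁻¹),
    abs_of_pos (Real.exp_pos _), mul_assoc (k * varWeight γ v₀ * v₀⁻¹)]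
  exact mul_le_mul (by gcongr) ((mul_le_of_le_one_right (abs_nonneg _) he).trans habs)
    (by positivity) (by positivity)

/-- This form is needed because a wrong parameter can reproduce the true conditional law for some
values of `x`, so strictness may hold only on a set of positive measure. -/
theorem integral_lt_of_ae_le_of_not_ae_eq {T : Type*} [MeasurableSpace T] {Q : Measure T}
    {f g : T → ℝ} (hf : Integrable f Q) (hg : Integrable g Q) (hle : ∀ᵐ t ∂Q, f t ≤ g t)
    (hne : ¬ ∀ᵐ t ∂Q, f t = g t) : ∫ t, f t ∂Q < ∫ t, g t ∂Q :=
  lt_of_le_of_ne (integral_mono_ae hf hg hle) fun h =>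
    hne ((integral_eq_iff_of_ae_le hf hg hle).1 h)

variable {Ω : Type*} [MeasurableSpace Ω] {P : Measure Ω} [IsProbabilityMeasure P] {p : ℕ}
  {β : Cov p} {A DL DU B : ℝ} {x : Ω → Cov p} {D y : Ω → ℝ}

/-- Identifiability of `β`: if `xᵀu = 0` almost surely then `E[xxᵀ]u = 0`, which positive
definiteness forbids for `u ≠ 0`. Boundedness supplies the integrability. -/
theorem eq_zero_of_inner_ae_eq_zero (hx : Measurable x) (hB : ∀ᵐ ω ∂P, ‖x ω‖ ≤ B)
    (hpd : (Matrix.of fun j k : Fin p => ∫ ω, x ω j * x ω k ∂P).PosDef) {u : Cov p}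
    (hu : ∀ᵐ ω ∂P, inner ℝ (x ω) u = 0) : u = 0 := by
  by_contra hne
  have hne' : (fun j => u j) ≠ (0 : Fin p → ℝ) := fun h => hne (by ext j; exact congrFun h j)
  have hpos := hpd.dotProduct_mulVec_pos hne'
  have hint : ∀ j l, Integrable (fun ω => x ω j * x ω l) P := fun j l => by
    have hm : ∀ j, Measurable fun ω => x ω j := fun j => by fun_prop
    refine Integrable.mono' (integrable_const (B * B)) ((hm j).mul (hm l)).aestronglyMeasurable ?_
    filter_upwards [hB] with ω hω
    rw [norm_mul]
    have h1 := (PiLp.norm_apply_le (x ω) j).trans hω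
    have h2 := (PiLp.norm_apply_le (x ω) l).trans hω
    exact mul_le_mul h1 h2 (norm_nonneg _) ((norm_nonneg _).trans hω)
  have hzero : (Matrix.of fun j k : Fin p => ∫ ω, x ω j * x ω k ∂P).mulVec (fun j => u j) = 0 := by
    funext j
    simp only [Matrix.mulVec, dotProduct, Matrix.of_apply, Pi.zero_apply]
    simp_rw [← integral_mul_const]
    rw [← integral_finsetSum _ fun l _ => (hint j l).mul_const _]
    refine (integral_congr_ae (g := fun _ => (0 : ℝ)) ?_).trans (integral_zero _ _)
    filter_upwards [hu] with ω hω
    have : inner ℝ (x ω) u = ∑ l, x ω l * u l := by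
      simp [PiLp.inner_apply, mul_comm]
    rw [this] at hω
    simp_rw [mul_assoc, ← Finset.mul_sum, hω]
    simp
  rw [hzero] at hpos
  simp at hpos

/-- Regularity of the observations of one area, seen through the law of `(x, D, y)` only. -/
structure IsObs {Ω : Type*} [MeasurableSpace Ω] {p : ℕ} (P : Measure Ω) (β : Cov p)
    (A DL DU B : ℝ) (x : Ω → Cov p) (D y : Ω → ℝ) : Prop where
  meas_x : Measurable x
  meas_D : Measurable D
  meas_y : Measurable y
  A_pos : 0 < A
  DL_pos : 0 < DL
  D_mem : ∀ᵐ ω ∂P, DL ≤ D ω ∧ D ω ≤ DU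
  x_le : ∀ᵐ ω ∂P, ‖x ω‖ ≤ B
  law : P.map (fun ω => ((x ω, D ω), (y ω - inner ℝ (x ω) β) / √(A + D ω)))
      = (P.map (fun ω => (x ω, D ω))).prod (gaussianReal 0 1)

namespace IsObs

theorem v_pos {P : Measure Ω} (h : IsObs P β A DL DU B x D y) : ∀ᵐ ω ∂P, 0 < D ω ∧ 0 < A + D ω := by
  filter_upwards [h.D_mem] with ω hω
  have := h.DL_pos
  have := h.A_pos
  constructor <;> linarith [hω.1]

theorem obs_eq {P : Measure Ω} (h : IsObs P β A DL DU B x D y) :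
    ∀ᵐ ω ∂P, y ω = inner ℝ (x ω) β + √(A + D ω) * ((y ω - inner ℝ (x ω) β) / √(A + D ω)) := by
  filter_upwards [h.v_pos] with ω hω
  rw [mul_div_cancel₀ _ (Real.sqrt_pos.2 hω.2).ne']
  ring

/-- Conditioning on `(x, D)`: expectations become iterated integrals whose inner part is a Gaussian
integral evaluated earlier. -/
theorem integral_comp (h : IsObs P β A DL DU B x D y) {G : Cov p × ℝ → ℝ → ℝ}
    (hG : Measurable (Function.uncurry G)) (hint : Integrable (fun ω => G (x ω, D ω) (y ω)) P) :
    Integrable (fun z => ∫ r, G z (inner ℝ z.1 β + √(A + z.2) * r) ∂gaussianReal 0 1)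
      (P.map fun ω => (x ω, D ω)) ∧
    ∫ ω, G (x ω, D ω) (y ω) ∂P
      = ∫ z, ∫ r, G z (inner ℝ z.1 β + √(A + z.2) * r) ∂gaussianReal 0 1
        ∂(P.map fun ω => (x ω, D ω)) := by
  have hx := h.meas_x
  have hD := h.meas_D
  have hy := h.meas_y
  have hin : Measurable fun ω => inner ℝ (x ω) β := hx.inner_const
  have : IsProbabilityMeasure (P.map fun ω => (x ω, D ω)) :=
    Measure.isProbabilityMeasure_map (by fun_prop)
  have hH : Measurable fun q : (Cov p × ℝ) × ℝ =>
      G q.1 (inner ℝ q.1.1 β + √(A + q.1.2) * q.2) := by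
    have : Measurable fun q : (Cov p × ℝ) × ℝ => inner ℝ q.1.1 β :=
      Measurable.inner_const (by fun_prop)
    exact hG.comp (f := fun q : (Cov p × ℝ) × ℝ =>
      (q.1, inner ℝ q.1.1 β + √(A + q.1.2) * q.2)) (by fun_prop)
  have hR : Measurable fun ω => ((x ω, D ω), (y ω - inner ℝ (x ω) β) / √(A + D ω)) := by fun_prop
  have hcongr : (fun ω => G (x ω, D ω) (y ω)) =ᵐ[P] fun ω => G (x ω, D ω)
      (inner ℝ (x ω) β + √(A + D ω) * ((y ω - inner ℝ (x ω) β) / √(A + D ω))) := by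
    filter_upwards [h.obs_eq] with ω hω
    exact congrArg (G (x ω, D ω)) hω
  have hint' : Integrable (fun q : (Cov p × ℝ) × ℝ =>
      G q.1 (inner ℝ q.1.1 β + √(A + q.1.2) * q.2))
      ((P.map (fun ω => (x ω, D ω))).prod (gaussianReal 0 1)) := by
    rw [← h.law, integrable_map_measure hH.aestronglyMeasurable hR.aemeasurable]
    exact hint.congr hcongr
  refine ⟨hint'.integral_prod_left, ?_⟩
  rw [integral_congr_ae hcongr, ← integral_prod _ hint', ← h.law,
    integral_map hR.aemeasurable hH.aestronglyMeasurable]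

theorem integrable_sq (h : IsObs P β A DL DU B x D y) : Integrable (fun ω => y ω ^ 2) P := by
  have hx := h.meas_x
  have hD := h.meas_D
  have hy := h.meas_y
  have hin : Measurable fun ω => inner ℝ (x ω) β := hx.inner_const
  have : IsProbabilityMeasure (P.map fun ω => (x ω, D ω)) :=
    Measure.isProbabilityMeasure_map (by fun_prop)
  have hR : Measurable fun ω => ((x ω, D ω), (y ω - inner ℝ (x ω) β) / √(A + D ω)) := by fun_prop
  have h1 : Integrable (fun q : (Cov p × ℝ) × ℝ => q.2 ^ 2)
      ((P.map (fun ω => (x ω, D ω))).prod (gaussianReal 0 1)) :=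
    (integrable_sq_gaussianReal 1).comp_snd _
  rw [← h.law, integrable_map_measure (by fun_prop) hR.aemeasurable] at h1
  refine Integrable.mono' ((integrable_const (2 * (B * ‖β‖) ^ 2)).add
    (h1.const_mul (2 * (A + DU)))) (by fun_prop) ?_
  filter_upwards [h.obs_eq, h.D_mem, h.x_le, h.v_pos] with ω hω hDω hxω hvω
  have hμ : |inner ℝ (x ω) β| ≤ B * ‖β‖ :=
    (abs_real_inner_le_norm _ _).trans (by gcongr)
  have hμ2 : (inner ℝ (x ω) β) ^ 2 ≤ (B * ‖β‖) ^ 2 := by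
    rw [← sq_abs]; gcongr
  simp only [Pi.add_apply, Function.comp]
  rw [Real.norm_of_nonneg (sq_nonneg _), hω]
  set r := (y ω - inner ℝ (x ω) β) / √(A + D ω)
  set μ := inner ℝ (x ω) β
  have hs : (√(A + D ω) * r) ^ 2 ≤ (A + DU) * r ^ 2 := by
    rw [mul_pow, Real.sq_sqrt hvω.2.le]
    gcongr
    exact hDω.2
  have : (μ + √(A + D ω) * r - μ) / √(A + D ω) = r := by
    rw [add_sub_cancel_left, mul_div_cancel_left₀ _ (Real.sqrt_pos.2 hvω.2).ne']
  rw [this]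
  nlinarith [sq_nonneg (μ - √(A + D ω) * r)]

theorem integrable_envelope (h : IsObs P β A DL DU B x D y) (C : ℝ) :
    Integrable (fun ω => C * (1 + y ω ^ 2)) P :=
  ((integrable_const 1).add h.integrable_sq).const_mul C

end IsObs

theorem measurable_likForm {T : Type*} [MeasurableSpace T] {μ v y : T → ℝ} (hμ : Measurable μ)
    (hv : Measurable v) (hy : Measurable y) (k γ : ℝ) :
    Measurable fun t => likForm k γ (μ t) (v t) (y t) := by
  unfold likForm varWeight
  split_ifs <;> fun_prop

theorem measurable_curvForm {T : Type*} [MeasurableSpace T] {μ v y : T → ℝ} (hμ : Measurable μ)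
    (hv : Measurable v) (hy : Measurable y) (k γ : ℝ) :
    Measurable fun t => curvForm k γ (μ t) (v t) (y t) := by
  unfold curvForm varWeight
  fun_prop

theorem integrable_curvForm_gaussianReal {k γ v : ℝ} (hk : 0 < k) (hγ : 0 ≤ γ) (hv : 0 < v)
    (μ δ s : ℝ) : Integrable (fun r => curvForm k γ μ v (δ + s * r)) (gaussianReal 0 1) := by
  obtain ⟨C, -, hC⟩ := exists_curvForm_bound hk hγ hv |μ|
  refine Integrable.mono' (((integrable_const 1).add
    (integrable_affine_sq_gaussianReal δ s)).const_mul C) ?_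
    (ae_of_all _ fun r => hC μ v _ le_rfl le_rfl)
  exact (measurable_curvForm measurable_const measurable_const (by fun_prop) k γ).aestronglyMeasurable

namespace IsObs

theorem map_ae {P : Measure Ω} (h : IsObs P β A DL DU B x D y) :
    ∀ᵐ z ∂(P.map fun ω => (x ω, D ω)), DL ≤ z.2 ∧ 0 < z.2 ∧ 0 < A + z.2 := by
  have hx := h.meas_x
  have hD := h.meas_D
  refine (ae_map_iff (by fun_prop) ?_).2 ?_
  · exact (measurableSet_le measurable_const measurable_snd).inter
      ((measurableSet_lt measurable_const measurable_snd).inter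
        (measurableSet_lt measurable_const (measurable_snd.const_add A)))
  · filter_upwards [h.D_mem, h.v_pos] with ω h1 h2 using ⟨h1.1, h2.1, h2.2⟩

/-- The expected generalized likelihood is uniquely maximized at the true parameter. -/
theorem integral_lik_lt (h : IsObs P β A DL DU B x D y)
    (hpd : (Matrix.of fun j k : Fin p => ∫ ω, x ω j * x ω k ∂P).PosDef) {k γ : ℝ} (hk : 0 < k)
    (hγ : 0 ≤ γ) {ψ : Param p} (hψ : 0 < ψ.2) (hne : ψ ≠ (β, A))
    (h1 : Integrable (fun ω => likForm k γ (inner ℝ (x ω) ψ.1) (ψ.2 + D ω) (y ω)) P)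
    (h2 : Integrable (fun ω => likForm k γ (inner ℝ (x ω) β) (A + D ω) (y ω)) P) :
    ∫ ω, likForm k γ (inner ℝ (x ω) ψ.1) (ψ.2 + D ω) (y ω) ∂P
      < ∫ ω, likForm k γ (inner ℝ (x ω) β) (A + D ω) (y ω) ∂P := by
  have hx := h.meas_x
  have hD := h.meas_D
  have hm : ∀ (b : Cov p) (a : ℝ), Measurable (Function.uncurry fun (z : Cov p × ℝ) (y : ℝ) =>
      likForm k γ (inner ℝ z.1 b) (a + z.2) y) := fun b a => by
    have : Measurable fun q : (Cov p × ℝ) × ℝ => inner ℝ q.1.1 b :=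
      Measurable.inner_const (by fun_prop)
    exact measurable_likForm this (by fun_prop) measurable_snd k γ
  obtain ⟨i1, e1⟩ := h.integral_comp (hm ψ.1 ψ.2) h1
  obtain ⟨i2, e2⟩ := h.integral_comp (hm β A) h2
  rw [e1, e2]
  have hlt : ∀ᵐ z ∂(P.map fun ω => (x ω, D ω)),
      (inner ℝ z.1 ψ.1, ψ.2 + z.2) ≠ (inner ℝ z.1 β, A + z.2) →
      ∫ r, likForm k γ (inner ℝ z.1 ψ.1) (ψ.2 + z.2) (inner ℝ z.1 β + √(A + z.2) * r)
        ∂gaussianReal 0 1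
      < ∫ r, likForm k γ (inner ℝ z.1 β) (A + z.2) (inner ℝ z.1 β + √(A + z.2) * r)
        ∂gaussianReal 0 1 := by
    filter_upwards [h.map_ae] with z hz hne'
    exact integral_likForm_lt hk hγ (by linarith [hz.2.1]) hz.2.2 hne'
  refine integral_lt_of_ae_le_of_not_ae_eq i1 i2 ?_ ?_
  · filter_upwards [hlt] with z hz
    by_cases hc : (inner ℝ z.1 ψ.1, ψ.2 + z.2) = (inner ℝ z.1 β, A + z.2)
    · rw [Prod.mk.injEq] at hc
      rw [hc.1, hc.2]
    · exact (hz hc).le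
  -- Equality almost everywhere would force the same conditional mean and variance for almost every
  -- `(x, D)`, hence `ψ = (β, A)`.
  · intro hall
    have heq : ∀ᵐ z ∂(P.map fun ω => (x ω, D ω)),
        inner ℝ z.1 ψ.1 = inner ℝ z.1 β ∧ ψ.2 + z.2 = A + z.2 := by
      filter_upwards [hall, hlt] with z hz hz'
      by_contra hc
      exact (hz' fun hc' => hc (Prod.mk.inj hc')).ne hz
    have heq' := ae_of_ae_map (by fun_prop) heq
    have hA : ψ.2 = A := by
      obtain ⟨ω, hω⟩ := heq'.exists
      linarith [hω.2]
    have hβ : ψ.1 - β = 0 := by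
      refine eq_zero_of_inner_ae_eq_zero hx h.x_le hpd ?_
      filter_upwards [heq'] with ω hω
      rw [inner_sub_right, hω.1, sub_self]
    exact hne (Prod.ext (sub_eq_zero.1 hβ) hA)

/-- At the true parameter the expected posterior variance is smallest for `γ = 0`. -/
theorem integral_var_lt (h : IsObs P β A DL DU B x D y)
    (hA3 : (2 * Real.pi)⁻¹ * Real.exp (-3) < A + DL) {k γ : ℝ} (hk : 0 < k)
    (hk' : k ≤ (1 + γ) ^ (γ / (2 * (1 + γ)))) (hγ : 0 < γ)
    (h0 : Integrable (fun ω => D ω - D ω ^ 2 *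
      curvForm 1 0 (inner ℝ (x ω) β) (A + D ω) (y ω)) P)
    (h1 : Integrable (fun ω => D ω - D ω ^ 2 *
      curvForm k γ (inner ℝ (x ω) β) (A + D ω) (y ω)) P) :
    ∫ ω, (D ω - D ω ^ 2 * curvForm 1 0 (inner ℝ (x ω) β) (A + D ω) (y ω)) ∂P
      < ∫ ω, (D ω - D ω ^ 2 * curvForm k γ (inner ℝ (x ω) β) (A + D ω) (y ω)) ∂P := by
  have hx := h.meas_x
  have hD := h.meas_D
  have : IsProbabilityMeasure (P.map fun ω => (x ω, D ω)) :=
    Measure.isProbabilityMeasure_map (by fun_prop)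
  have hm : ∀ k γ : ℝ, Measurable (Function.uncurry fun (z : Cov p × ℝ) (y : ℝ) =>
      z.2 - z.2 ^ 2 * curvForm k γ (inner ℝ z.1 β) (A + z.2) y) := fun k γ => by
    have h1 : Measurable fun q : (Cov p × ℝ) × ℝ => inner ℝ q.1.1 β :=
      Measurable.inner_const (by fun_prop)
    have h2 : Measurable fun q : (Cov p × ℝ) × ℝ =>
        curvForm k γ (inner ℝ q.1.1 β) (A + q.1.2) q.2 :=
      measurable_curvForm h1 (by fun_prop) measurable_snd k γ
    simp only [Function.uncurry_def]
    fun_prop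
  obtain ⟨i0, e0⟩ := h.integral_comp (hm 1 0) h0
  obtain ⟨i1, e1⟩ := h.integral_comp (hm k γ) h1
  rw [e0, e1]
  have hlt : ∀ᵐ z ∂(P.map fun ω => (x ω, D ω)),
      ∫ r, (z.2 - z.2 ^ 2 * curvForm 1 0 (inner ℝ z.1 β) (A + z.2)
        (inner ℝ z.1 β + √(A + z.2) * r)) ∂gaussianReal 0 1
      < ∫ r, (z.2 - z.2 ^ 2 * curvForm k γ (inner ℝ z.1 β) (A + z.2)
        (inner ℝ z.1 β + √(A + z.2) * r)) ∂gaussianReal 0 1 := by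
    filter_upwards [h.map_ae] with z hz
    rw [integral_sub (integrable_const _) ((integrable_curvForm_gaussianReal hk hγ.le hz.2.2
      (inner ℝ z.1 β) (inner ℝ z.1 β) √(A + z.2)).const_mul _), integral_const_mul]
    simp only [curvForm_zero, integral_const, probReal_univ, one_smul]
    have h3 := integral_curvForm_lt hk hk' hγ hz.2.2 (by linarith [hz.1]) (inner ℝ z.1 β)
    have h4 : 0 < z.2 ^ 2 := pow_pos hz.2.1 2
    have := mul_lt_mul_of_pos_left h3 h4
    linarith
  refine integral_lt_of_ae_le_of_not_ae_eq i0 i1 ?_ ?_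
  · filter_upwards [hlt] with z hz using hz.le
  · intro hall
    obtain ⟨z, hz⟩ := (hall.and hlt).exists
    exact hz.2.ne hz.1

end IsObs

end FayHerriot

/-! ### Strong consistency and the eventual selection of `γ = 0`. -/

namespace FayHerriot

variable {Ω : Type*} [MeasurableSpace Ω] {P : Measure Ω} [IsProbabilityMeasure P] {p : ℕ}
  {β : Cov p} {A DL DU B : ℝ}

/-- The i.i.d. data, seen through the law of `(y, x, D)` only. -/
structure IsIIDObs {Ω : Type*} [MeasurableSpace Ω] {p : ℕ} (P : Measure Ω) (β : Cov p)
    (A DL DU B : ℝ) (x : ℕ → Ω → Cov p) (D y : ℕ → Ω → ℝ) : Prop where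
  obs : ∀ i, IsObs P β A DL DU B (x i) (D i) (y i)
  indep : iIndepFun (fun i ω => (y i ω, x i ω, D i ω)) P
  ident : ∀ i, IdentDistrib (fun ω => (y i ω, x i ω, D i ω)) (fun ω => (y 0 ω, x 0 ω, D 0 ω)) P P

namespace IsIIDObs

variable {x : ℕ → Ω → Cov p} {D y : ℕ → Ω → ℝ} {Ψ : Set (Param p)}

/-- Uniform law of large numbers over `Ψ` for an area-level function with a quadratic envelope. -/
theorem uniform_law (h : IsIIDObs P β A DL DU B x D y) (hΨ : IsCompact Ψ)
    {f : Param p → Cov p → ℝ → ℝ → ℝ}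
    (hcont : Continuous fun q : (ℝ × Cov p × ℝ) × Ψ => f q.2 q.1.2.1 (max q.1.2.2 DL) q.1.1)
    (hbound : ∃ C, ∀ ψ ∈ Ψ, ∀ x d y, ‖x‖ ≤ B → DL ≤ d → d ≤ DU → |f ψ x d y| ≤ C * (1 + y ^ 2)) :
    (∀ t : Ψ, Integrable (fun ω => f t (x 0 ω) (D 0 ω) (y 0 ω)) P) ∧
    (Continuous fun t : Ψ => ∫ ω, f t (x 0 ω) (D 0 ω) (y 0 ω) ∂P) ∧
    ∀ᵐ ω ∂P, TendstoUniformly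
      (fun (m : ℕ) (t : Ψ) => (m : ℝ)⁻¹ * ∑ j ∈ Finset.range m, f t (x j ω) (D j ω) (y j ω))
      (fun t : Ψ => ∫ ω, f t (x 0 ω) (D 0 ω) (y 0 ω) ∂P) atTop := by
  have : CompactSpace Ψ := isCompact_iff_compactSpace.1 hΨ
  obtain ⟨C, hC⟩ := hbound
  -- Truncating `d` below at `DL` keeps the marginal variance positive everywhere, so `F` can be
  -- continuous on the whole space; almost surely it changes nothing.
  let F : C((ℝ × Cov p × ℝ) × Ψ, ℝ) := ⟨_, hcont⟩
  have hF : ∀ q, F q = f q.2 q.1.2.1 (max q.1.2.2 DL) q.1.1 := fun q => rfl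
  have hZ : ∀ i, Measurable fun ω => (y i ω, x i ω, D i ω) := fun i =>
    (h.obs i).meas_y.prodMk ((h.obs i).meas_x.prodMk (h.obs i).meas_D)
  have hFeq : ∀ i, ∀ᵐ ω ∂P, ∀ t : Ψ,
      F ((y i ω, x i ω, D i ω), t) = f t (x i ω) (D i ω) (y i ω) := fun i => by
    filter_upwards [(h.obs i).D_mem] with ω hω t
    rw [hF, max_eq_left hω.1]
  have hb : ∀ᵐ ω ∂P, ∀ t : Ψ, |F ((y 0 ω, x 0 ω, D 0 ω), t)| ≤ C * (1 + y 0 ω ^ 2) := by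
    filter_upwards [hFeq 0, (h.obs 0).D_mem, (h.obs 0).x_le] with ω h1 h2 h3 t
    rw [h1]
    exact hC t t.2 _ _ _ h3 h2.1 h2.2
  have hint : ∀ t : Ψ, ∫ ω, F ((y 0 ω, x 0 ω, D 0 ω), t) ∂P
      = ∫ ω, f t (x 0 ω) (D 0 ω) (y 0 ω) ∂P := fun t =>
    integral_congr_ae (by filter_upwards [hFeq 0] with ω hω using hω t)
  obtain ⟨h1, h2⟩ := uniform_strong_law F hZ (fun i j hij => h.indep.indepFun hij) h.ident
    ((h.obs 0).integrable_envelope C) hb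
  simp_rw [hint] at h1 h2
  refine ⟨fun t => ?_, h1, ?_⟩
  · have hm : Measurable fun ω => F ((y 0 ω, x 0 ω, D 0 ω), t) :=
      F.continuous.measurable.comp (Measurable.prodMk (hZ 0) measurable_const)
    refine (Integrable.mono' ((h.obs 0).integrable_envelope C) hm.aestronglyMeasurable ?_).congr ?_
    · filter_upwards [hb] with ω hω using hω t
    · filter_upwards [hFeq 0] with ω hω using hω t
  · filter_upwards [h2, ae_all_iff.2 hFeq] with ω hω hω'
    simp_rw [hω'] at hω
    exact hω

theorem exists_param_bound (hΨ : IsCompact Ψ) :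
    ∃ R, ∀ ψ ∈ Ψ, ψ.2 ≤ R ∧ ∀ x : Cov p, ‖x‖ ≤ B → |inner ℝ x ψ.1| ≤ B * R := by
  obtain ⟨R, hR⟩ := hΨ.isBounded.exists_norm_le
  refine ⟨R, fun ψ hψ => ⟨?_, fun x hx => ?_⟩⟩
  · exact (le_abs_self _).trans ((norm_snd_le ψ).trans (hR ψ hψ))
  · exact (abs_real_inner_le_norm _ _).trans
      (mul_le_mul hx ((norm_fst_le ψ).trans (hR ψ hψ)) (norm_nonneg _) ((norm_nonneg _).trans hx))

theorem continuous_components {Ψ : Set (Param p)} (hDL : 0 < DL) (hΨpos : ∀ ψ ∈ Ψ, 0 < ψ.2) :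
    (Continuous fun q : (ℝ × Cov p × ℝ) × Ψ => inner ℝ q.1.2.1 (q.2 : Param p).1) ∧
    (Continuous fun q : (ℝ × Cov p × ℝ) × Ψ => (q.2 : Param p).2 + max q.1.2.2 DL) ∧
    ∀ q : (ℝ × Cov p × ℝ) × Ψ, 0 < (q.2 : Param p).2 + max q.1.2.2 DL := by
  refine ⟨Continuous.inner (by fun_prop) (by fun_prop), by fun_prop, fun q => ?_⟩
  exact add_pos (hΨpos _ q.2.2) (hDL.trans_le (le_max_right _ _))

theorem uniform_law_lik (h : IsIIDObs P β A DL DU B x D y) (hΨ : IsCompact Ψ)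
    (hΨpos : ∀ ψ ∈ Ψ, 0 < ψ.2) {k γ : ℝ} (hk : 0 < k) (hγ : 0 ≤ γ) :
    (∀ t : Ψ, Integrable
      (fun ω => likForm k γ (inner ℝ (x 0 ω) t.1.1) (t.1.2 + D 0 ω) (y 0 ω)) P) ∧
    (Continuous fun t : Ψ =>
      ∫ ω, likForm k γ (inner ℝ (x 0 ω) t.1.1) (t.1.2 + D 0 ω) (y 0 ω) ∂P) ∧
    ∀ᵐ ω ∂P, TendstoUniformly
      (fun (m : ℕ) (t : Ψ) => (m : ℝ)⁻¹ * ∑ j ∈ Finset.range m,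
        likForm k γ (inner ℝ (x j ω) t.1.1) (t.1.2 + D j ω) (y j ω))
      (fun t : Ψ => ∫ ω, likForm k γ (inner ℝ (x 0 ω) t.1.1) (t.1.2 + D 0 ω) (y 0 ω) ∂P)
      atTop := by
  have hDL := (h.obs 0).DL_pos
  refine h.uniform_law hΨ
    (f := fun ψ x d y => likForm k γ (inner ℝ x ψ.1) (ψ.2 + d) y) ?_ ?_
  · obtain ⟨c1, c2, c3⟩ := continuous_components (p := p) hDL hΨpos
    exact continuous_likForm c1 c2 (by fun_prop) c3 k γ
  · obtain ⟨R, hR⟩ := exists_param_bound (B := B) hΨ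
    obtain ⟨C, hC⟩ := exists_likForm_bound hk hγ hDL (R + DU) (B * R)
    refine ⟨C, fun ψ hψ x d y hx h1 h2 => hC _ _ _ ?_ ?_ ((hR ψ hψ).2 x hx)⟩
    · linarith [hΨpos ψ hψ]
    · linarith [(hR ψ hψ).1]

theorem uniform_law_var (h : IsIIDObs P β A DL DU B x D y) (hΨ : IsCompact Ψ)
    (hΨpos : ∀ ψ ∈ Ψ, 0 < ψ.2) {k γ : ℝ} (hk : 0 < k) (hγ : 0 ≤ γ) :
    (∀ t : Ψ, Integrable (fun ω => D 0 ω - D 0 ω ^ 2 *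
      curvForm k γ (inner ℝ (x 0 ω) t.1.1) (t.1.2 + D 0 ω) (y 0 ω)) P) ∧
    (Continuous fun t : Ψ => ∫ ω, (D 0 ω - D 0 ω ^ 2 *
      curvForm k γ (inner ℝ (x 0 ω) t.1.1) (t.1.2 + D 0 ω) (y 0 ω)) ∂P) ∧
    ∀ᵐ ω ∂P, TendstoUniformly
      (fun (m : ℕ) (t : Ψ) => (m : ℝ)⁻¹ * ∑ j ∈ Finset.range m, (D j ω - D j ω ^ 2 *
        curvForm k γ (inner ℝ (x j ω) t.1.1) (t.1.2 + D j ω) (y j ω)))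
      (fun t : Ψ => ∫ ω, (D 0 ω - D 0 ω ^ 2 *
        curvForm k γ (inner ℝ (x 0 ω) t.1.1) (t.1.2 + D 0 ω) (y 0 ω)) ∂P) atTop := by
  have hDL := (h.obs 0).DL_pos
  refine h.uniform_law hΨ
    (f := fun ψ x d y => d - d ^ 2 * curvForm k γ (inner ℝ x ψ.1) (ψ.2 + d) y) ?_ ?_
  · obtain ⟨c1, c2, c3⟩ := continuous_components (p := p) hDL hΨpos
    have := continuous_curvForm c1 c2 (y := fun q => q.1.1) (by fun_prop) c3 k γ
    fun_prop
  · obtain ⟨R, hR⟩ := exists_param_bound (B := B) hΨ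
    obtain ⟨C, hC0, hC⟩ := exists_curvForm_bound hk hγ hDL (B * R)
    refine ⟨DU + DU ^ 2 * C, fun ψ hψ x d y hx h1 h2 => ?_⟩
    have h3 := hC (inner ℝ x ψ.1) (ψ.2 + d) y (by linarith [hΨpos ψ hψ]) ((hR ψ hψ).2 x hx)
    have hd : 0 < d := hDL.trans_le h1
    have hy := sq_nonneg y
    calc _ ≤ |d| + |d ^ 2 * curvForm k γ (inner ℝ x ψ.1) (ψ.2 + d) y| := abs_sub _ _
      _ = d + d ^ 2 * |curvForm k γ (inner ℝ x ψ.1) (ψ.2 + d) y| := by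
          rw [abs_of_pos hd, abs_mul, abs_of_pos (pow_pos hd 2)]
      _ ≤ DU + DU ^ 2 * (C * (1 + y ^ 2)) := by gcongr
      _ ≤ _ := by nlinarith [hd.trans_le h2]

variable {c : ℝ → ℝ → ℝ → ℝ} {k : ℝ → ℝ}

/-- Strong consistency of the `γ`-estimator. -/
theorem tendsto_estimate (h : IsIIDObs P β A DL DU B x D y) (hk : IsNormFactor c k)
    (hpd : (Matrix.of fun j k : Fin p => ∫ ω, x 0 ω j * x 0 ω k ∂P).PosDef)
    (hΨ : IsCompact Ψ) (hΨpos : ∀ ψ ∈ Ψ, 0 < ψ.2) (hmem : (β, A) ∈ Ψ) {γ : ℝ} (hγ : 0 ≤ γ)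
    {ψhat : ℕ → Ω → Param p}
    (hψ : ∀ m, ∀ᵐ ω ∂P, IsGammaEstimate c Ψ γ m
      (fun j => x j ω) (fun j => D j ω) (fun j => y j ω) (ψhat m ω)) :
    ∀ᵐ ω ∂P, Tendsto (fun m => ψhat m ω) atTop (𝓝 (β, A)) := by
  have : CompactSpace Ψ := isCompact_iff_compactSpace.1 hΨ
  obtain ⟨hi, hc, hu⟩ := h.uniform_law_lik hΨ hΨpos (hk.pos γ hγ) hγ
  filter_upwards [hu, ae_all_iff.2 hψ, ae_all_iff.2 fun j => (h.obs j).v_pos] with ω hu hψ hD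
  have hlik : ∀ ψ ∈ Ψ, ∀ j, areaLik c γ ψ (x j ω) (D j ω) (y j ω)
      = likForm (k γ) γ (inner ℝ (x j ω) ψ.1) (ψ.2 + D j ω) (y j ω) := fun ψ hψ j =>
    areaLik_eq hk hγ (add_pos (hΨpos ψ hψ) (hD j).1) _ _
  have key := tendsto_argmax hc hu (t₀ := ⟨(β, A), hmem⟩)
    (fun t ht => (h.obs 0).integral_lik_lt hpd (hk.pos γ hγ) hγ (hΨpos t t.2)
      (fun hcon => ht (Subtype.ext hcon)) (hi t) (hi ⟨(β, A), hmem⟩))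
    (s := fun m => ⟨ψhat m ω, (hψ m).1⟩) (fun m t => by
      have h1 := (hψ m).2 t t.2
      simp_rw [hlik t t.2, hlik _ (hψ m).1] at h1
      exact mul_le_mul_of_nonneg_left h1 (by positivity))
  exact (continuous_subtype_val.tendsto _).comp key

/-- The average estimated posterior variance converges to its expectation at the truth. -/
theorem tendsto_average_postVar (h : IsIIDObs P β A DL DU B x D y) (hk : IsNormFactor c k)
    (hpd : (Matrix.of fun j k : Fin p => ∫ ω, x 0 ω j * x 0 ω k ∂P).PosDef)
    (hΨ : IsCompact Ψ) (hΨpos : ∀ ψ ∈ Ψ, 0 < ψ.2) (hmem : (β, A) ∈ Ψ) {γ : ℝ} (hγ : 0 ≤ γ)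
    {ψhat : ℕ → Ω → Param p}
    (hψ : ∀ m, ∀ᵐ ω ∂P, IsGammaEstimate c Ψ γ m
      (fun j => x j ω) (fun j => D j ω) (fun j => y j ω) (ψhat m ω)) :
    ∀ᵐ ω ∂P, Tendsto (fun m : ℕ => (m : ℝ)⁻¹ * ∑ j ∈ Finset.range m,
        postVar c γ (ψhat m ω) (x j ω) (D j ω) (y j ω)) atTop
      (𝓝 (∫ ω, (D 0 ω - D 0 ω ^ 2 *
        curvForm (k γ) γ (inner ℝ (x 0 ω) β) (A + D 0 ω) (y 0 ω)) ∂P)) := by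
  obtain ⟨hi, hc, hu⟩ := h.uniform_law_var hΨ hΨpos (hk.pos γ hγ) hγ
  filter_upwards [hu, ae_all_iff.2 hψ, ae_all_iff.2 fun j => (h.obs j).v_pos,
    h.tendsto_estimate hk hpd hΨ hΨpos hmem hγ hψ] with ω hu hψ hD hlim
  have hlim' : Tendsto (fun m => (⟨ψhat m ω, (hψ m).1⟩ : Ψ)) atTop (𝓝 ⟨(β, A), hmem⟩) :=
    tendsto_subtype_rng.2 hlim
  -- The estimate depends on all the data, so a pointwise law would not suffice; uniform convergence
  -- to a continuous limit permits evaluation along it.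
  refine (hu.tendsto_comp hc.continuousAt hlim').congr fun m => ?_
  congr 1
  refine Finset.sum_congr rfl fun j _ => ?_
  exact (postVar_eq hk hγ (add_pos (hΨpos _ (hψ m).1) (hD j).1) _ _).symm

/-- Almost surely the selected value of `γ` is eventually `0`. -/
theorem eventually_optimalGamma_eq_zero (h : IsIIDObs P β A DL DU B x D y)
    (hk : IsNormFactor c k)
    (hpd : (Matrix.of fun j k : Fin p => ∫ ω, x 0 ω j * x 0 ω k ∂P).PosDef)
    (hΨ : IsCompact Ψ) (hΨpos : ∀ ψ ∈ Ψ, 0 < ψ.2) (hmem : (β, A) ∈ Ψ)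
    (hA3 : (2 * Real.pi)⁻¹ * Real.exp (-3) < A + DL)
    {Γ : Finset ℝ} (hΓ0 : (0 : ℝ) ∈ Γ) (hΓ : ∀ γ ∈ Γ, 0 ≤ γ) {ψhat : ℝ → ℕ → Ω → Param p}
    (hψ : ∀ γ ∈ Γ, ∀ m, ∀ᵐ ω ∂P, IsGammaEstimate c Ψ γ m
      (fun j => x j ω) (fun j => D j ω) (fun j => y j ω) (ψhat γ m ω)) {γop : ℕ → Ω → ℝ}
    (hγop : ∀ m, ∀ᵐ ω ∂P, IsOptimalGamma c Γ m (fun γ => ψhat γ m ω)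
      (fun j => x j ω) (fun j => D j ω) (fun j => y j ω) (γop m ω)) :
    ∀ᵐ ω ∂P, ∀ᶠ m in atTop, γop m ω = 0 := by
  have hlim : ∀ᵐ ω ∂P, ∀ γ ∈ Γ, Tendsto (fun m : ℕ => (m : ℝ)⁻¹ * ∑ j ∈ Finset.range m,
        postVar c γ (ψhat γ m ω) (x j ω) (D j ω) (y j ω)) atTop
      (𝓝 (∫ ω, (D 0 ω - D 0 ω ^ 2 *
        curvForm (k γ) γ (inner ℝ (x 0 ω) β) (A + D 0 ω) (y 0 ω)) ∂P)) :=
    (ae_ball_iff Γ.countable_toSet).2 fun γ hγ =>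
      h.tendsto_average_postVar hk hpd hΨ hΨpos hmem (hΓ γ hγ) (hψ γ hγ)
  filter_upwards [hlim, ae_all_iff.2 hγop] with ω hlim hopt
  -- The limits are strictly ordered, and finiteness of `Γ` gives one threshold in `m` for all `γ ≠
  -- 0`.
  have hev : ∀ᶠ m : ℕ in atTop, ∀ γ ∈ Γ, γ ≠ 0 →
      (m : ℝ)⁻¹ * ∑ j ∈ Finset.range m, postVar c 0 (ψhat 0 m ω) (x j ω) (D j ω) (y j ω)
      < (m : ℝ)⁻¹ * ∑ j ∈ Finset.range m, postVar c γ (ψhat γ m ω) (x j ω) (D j ω) (y j ω) := by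
    refine (Γ.eventually_all).2 fun γ hγ => ?_
    by_cases h0 : γ = 0
    · exact Eventually.of_forall fun m hm => absurd h0 hm
    have hpos : 0 < γ := lt_of_le_of_ne (hΓ γ hγ) (Ne.symm h0)
    have hvar : ∀ γ : ℝ, 0 ≤ γ → _ := fun γ hγ =>
      (h.uniform_law_var hΨ hΨpos (hk.pos γ hγ) hγ).1 ⟨(β, A), hmem⟩
    have hlt := (h.obs 0).integral_var_lt hA3 (hk.pos γ hpos.le) (hk.le γ hpos.le) hpos
      (by have := hvar 0 le_rfl; rwa [hk.zero] at this) (hvar γ hpos.le)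
    have hl0 := hlim 0 hΓ0
    rw [hk.zero] at hl0
    filter_upwards [hl0.eventually_lt (hlim γ hγ) hlt] with m hm _ using hm
  filter_upwards [hev] with m hm
  by_contra hne
  exact absurd (mul_le_mul_of_nonneg_left ((hopt m).2 0 hΓ0) (by positivity : 0 ≤ (m : ℝ)⁻¹))
    (not_le.2 (hm _ (hopt m).1 hne))

end IsIIDObs

end FayHerriot

/-! ### Coverage of the limiting interval and transfer to the selected one. -/

namespace FayHerriot

theorem tendsto_mem_Ioo_iff {f g : ℕ → ℝ} {a b t : ℝ} (hf : Tendsto f atTop (𝓝 a))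
    (hg : Tendsto g atTop (𝓝 b)) (ha : t ≠ a) (hb : t ≠ b) :
    ∀ᶠ m in atTop, (t ∈ Set.Ioo (f m) (g m) ↔ t ∈ Set.Ioo a b) := by
  have h1 : ∀ᶠ m in atTop, (f m < t ↔ a < t) := by
    rcases lt_or_gt_of_ne ha with h | h
    · filter_upwards [hf.eventually_const_lt h] with m hm
      exact iff_of_false hm.not_gt h.not_gt
    · filter_upwards [hf.eventually_lt_const h] with m hm
      exact iff_of_true hm h
  have h2 : ∀ᶠ m in atTop, (t < g m ↔ t < b) := by
    rcases lt_or_gt_of_ne hb with h | h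
    · filter_upwards [hg.eventually_const_lt h] with m hm
      exact iff_of_true hm h
    · filter_upwards [hg.eventually_lt_const h] with m hm
      exact iff_of_false hm.not_gt h.not_gt
  filter_upwards [h1, h2] with m h1 h2
  simp only [Set.mem_Ioo, h1, h2]

/-- The interval of level `z` in explicit form for `γ = 0`. -/
def plainInterval {p : ℕ} (z : ℝ) (ψ : Param p) (x : Cov p) (d y : ℝ) : Set ℝ :=
  Set.Ioo (y - d * ((y - inner ℝ x ψ.1) / (ψ.2 + d)) - z * √(d - d ^ 2 / (ψ.2 + d)))
    (y - d * ((y - inner ℝ x ψ.1) / (ψ.2 + d)) + z * √(d - d ^ 2 / (ψ.2 + d)))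

theorem robustInterval_zero {p : ℕ} {c : ℝ → ℝ → ℝ → ℝ} {k : ℝ → ℝ} (hk : IsNormFactor c k)
    {ψ : Param p} {d : ℝ} (hv : 0 < ψ.2 + d) (α : ℝ) (x : Cov p) (y : ℝ) :
    robustInterval c α 0 ψ x d y = plainInterval (upperQuantile (α / 2)) ψ x d y := by
  rw [robustInterval, postMean_zero hk hv, postVar_zero hk hv, plainInterval]

variable {Ω : Type*} [MeasurableSpace Ω] {P : Measure Ω} [IsProbabilityMeasure P] {p : ℕ}
  {β : Cov p} {A : ℝ} {x : Ω → Cov p} {D θ y : Ω → ℝ}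

theorem measurableSet_plainInterval {ψ : Ω → Param p} (hψ : Measurable ψ) (hx : Measurable x)
    (hD : Measurable D) (hθ : Measurable θ) (hy : Measurable y) (z : ℝ) :
    MeasurableSet {ω | θ ω ∈ plainInterval z (ψ ω) (x ω) (D ω) (y ω)} := by
  have hin : Measurable fun ω => inner ℝ (x ω) (ψ ω).1 := hx.inner hψ.fst
  have h2 := hψ.snd
  exact (measurableSet_lt (by fun_prop) hθ).inter (measurableSet_lt hθ (by fun_prop))

/-- Membership in the interval at the true parameter, in terms of the standardized error. -/
theorem mem_plainInterval_iff {z d t y : ℝ} {x : Cov p} (hA : 0 < A) (hd : 0 < d) :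
    t ∈ plainInterval z (β, A) x d y ↔
      (t - (y - d * ((y - inner ℝ x β) / (A + d)))) / √(d - d ^ 2 / (A + d)) ∈ Set.Ioo (-z) z := by
  have hs : 0 < √(d - d ^ 2 / (A + d)) := by
    rw [Real.sqrt_pos]
    have : d - d ^ 2 / (A + d) = A * d / (A + d) := by field_simp; ring
    rw [this]; positivity
  simp only [plainInterval, Set.mem_Ioo, lt_div_iff₀ hs, div_lt_iff₀ hs]
  constructor <;> rintro ⟨h1, h2⟩ <;> constructor <;> linarith

theorem IsModel.measureReal_plainInterval (h : IsModel P β A x D θ y) (hA : 0 < A)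
    (hx : Measurable x) (hD : Measurable D) (hθ : Measurable θ) (hy : Measurable y)
    (hDpos : ∀ᵐ ω ∂P, 0 < D ω) {α : ℝ} (hα0 : 0 < α) (hα1 : α < 1) :
    P.real {ω | θ ω ∈ plainInterval (upperQuantile (α / 2)) (β, A) (x ω) (D ω) (y ω)} = 1 - α := by
  have hin : Measurable fun ω => inner ℝ (x ω) β := hx.inner_const
  rw [← gaussianReal_Ioo_upperQuantile hα0 hα1, ← h.map_posterior hA hx hD hθ hy hDpos,
    map_measureReal_apply (by fun_prop) measurableSet_Ioo]
  refine measureReal_congr ?_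
  filter_upwards [hDpos] with ω hω
  exact propext (mem_plainInterval_iff hA hω)

/-- Membership is a discontinuous event, but the standardized posterior error has no atoms, so `θ`
almost surely misses both limiting endpoints; the indicators then converge almost surely. -/
theorem IsModel.tendsto_plainInterval (h : IsModel P β A x D θ y) (hA : 0 < A)
    (hx : Measurable x) (hD : Measurable D) (hθ : Measurable θ) (hy : Measurable y)
    (hDpos : ∀ᵐ ω ∂P, 0 < D ω) {ψ : ℕ → Ω → Param p} (hψm : ∀ m, Measurable (ψ m))
    (hψ : ∀ᵐ ω ∂P, Tendsto (fun m => ψ m ω) atTop (𝓝 (β, A))) (z : ℝ) :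
    Tendsto (fun m => P.real {ω | θ ω ∈ plainInterval z (ψ m ω) (x ω) (D ω) (y ω)}) atTop
      (𝓝 (P.real {ω | θ ω ∈ plainInterval z (β, A) (x ω) (D ω) (y ω)})) := by
  have hin : Measurable fun ω => inner ℝ (x ω) β := hx.inner_const
  have := nullSingletonClass_gaussianReal (μ := 0) (v := 1) one_ne_zero
  have hne : ∀ z : ℝ, ∀ᵐ ω ∂P, (θ ω - (y ω - D ω * ((y ω - inner ℝ (x ω) β) / (A + D ω))))
        / √(D ω - D ω ^ 2 / (A + D ω)) ≠ z := fun z => by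
    have h0 : ∀ᵐ t ∂gaussianReal 0 1, t ≠ z := by simp [ae_iff]
    rw [← h.map_posterior hA hx hD hθ hy hDpos] at h0
    exact ae_of_ae_map (p := fun t => t ≠ z) (by fun_prop) h0
  refine (ENNReal.tendsto_toReal (measure_ne_top _ _)).comp ?_
  refine tendsto_measure_of_ae_tendsto_indicator atTop
    (measurableSet_plainInterval measurable_const hx hD hθ hy z)
    (fun m => measurableSet_plainInterval (hψm m) hx hD hθ hy z) MeasurableSet.univ
    (measure_ne_top _ _) (Eventually.of_forall fun _ => Set.subset_univ _) ?_
  filter_upwards [hψ, hDpos, hne z, hne (-z)] with ω hω hd hz hz'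
  have hv : A + D ω ≠ 0 := by positivity
  have hs : √(D ω - D ω ^ 2 / (A + D ω)) ≠ 0 := by
    rw [Real.sqrt_ne_zero']
    have : D ω - D ω ^ 2 / (A + D ω) = A * D ω / (A + D ω) := by field_simp; ring
    rw [this]; positivity
  have hβ : Tendsto (fun m => inner ℝ (x ω) (ψ m ω).1) atTop (𝓝 (inner ℝ (x ω) β)) :=
    tendsto_const_nhds.inner ((continuous_fst.tendsto _).comp hω)
  have hvar : Tendsto (fun m => (ψ m ω).2 + D ω) atTop (𝓝 (A + D ω)) :=
    ((continuous_snd.tendsto _).comp hω).add_const _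
  have hmean : Tendsto (fun m => y ω - D ω * ((y ω - inner ℝ (x ω) (ψ m ω).1) / ((ψ m ω).2 + D ω)))
      atTop (𝓝 (y ω - D ω * ((y ω - inner ℝ (x ω) β) / (A + D ω)))) :=
    (((hβ.const_sub _).div hvar hv).const_mul _).const_sub _
  have hsd : Tendsto (fun m => z * √(D ω - D ω ^ 2 / ((ψ m ω).2 + D ω))) atTop
      (𝓝 (z * √(D ω - D ω ^ 2 / (A + D ω)))) :=
    (((tendsto_const_nhds.div hvar hv).const_sub _).sqrt).const_mul _
  refine tendsto_mem_Ioo_iff (hmean.sub hsd) (hmean.add hsd) (fun hc => hz' ?_) (fun hc => hz ?_)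
  · rw [div_eq_iff hs]; linarith
  · rw [div_eq_iff hs]; linarith

/-- Sets that agree off events of vanishing probability have the same limiting probability. -/
theorem tendsto_measureReal_of_agree {E E' G : ℕ → Set Ω} {l : ℝ}
    (hE' : Tendsto (fun m => P.real (E' m)) atTop (𝓝 l))
    (hG : ∀ m, MeasurableSet (G m)) (hev : ∀ᵐ ω ∂P, ∀ᶠ m in atTop, ω ∈ G m)
    (hagree : ∀ m, ∀ᵐ ω ∂P, ω ∈ G m → (ω ∈ E m ↔ ω ∈ E' m)) :
    Tendsto (fun m => P.real (E m)) atTop (𝓝 l) := by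
  have hGc : Tendsto (fun m => P.real (G m)ᶜ) atTop (𝓝 0) := by
    have h0 : Tendsto (fun m => P (G m)ᶜ) atTop (𝓝 (P ∅)) := by
      refine tendsto_measure_of_ae_tendsto_indicator atTop MeasurableSet.empty
        (fun m => (hG m).compl) MeasurableSet.univ (measure_ne_top _ _)
        (Eventually.of_forall fun _ => Set.subset_univ _) ?_
      filter_upwards [hev] with ω hω
      filter_upwards [hω] with m hm
      simp [hm]
    rw [measure_empty] at h0
    exact (ENNReal.tendsto_toReal ENNReal.zero_ne_top).comp h0
  -- Only monotonicity and subadditivity are used, so the events `E m` need not be measurable; this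
  -- suits the interval with randomly selected `γ`.
  have hle : ∀ {S T : ℕ → Set Ω}, (∀ m, ∀ᵐ ω ∂P, ω ∈ G m → (ω ∈ S m → ω ∈ T m)) →
      ∀ m, P.real (S m) ≤ P.real (T m) + P.real (G m)ᶜ := fun {S T} hST m => by
    refine le_trans ?_ (measureReal_union_le _ _)
    refine ENNReal.toReal_mono (measure_ne_top _ _) (measure_mono_ae ?_)
    filter_upwards [hST m] with ω hω hS
    by_cases hg : ω ∈ G m
    · exact Or.inl (hω hg hS)
    · exact Or.inr hg
  refine tendsto_of_tendsto_of_tendsto_of_le_of_le (by simpa using hE'.sub hGc)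
    (by simpa using hE'.add hGc) (fun m => ?_) (fun m => ?_)
  · have := hle (S := E') (T := E)
      (fun m => (hagree m).mono fun ω hω hg => (hω hg).2) m
    simp only
    linarith
  · exact hle (fun m => (hagree m).mono fun ω hω hg => (hω hg).1) m

end FayHerriot

theorem theorem2 {Ω : Type*} [MeasurableSpace Ω] (P : Measure Ω) [IsProbabilityMeasure P]
    {p : ℕ} (x : ℕ → Ω → FayHerriot.Cov p) (D θ y : ℕ → Ω → ℝ)
    (hx : ∀ i, Measurable (x i)) (hD : ∀ i, Measurable (D i))
    (hθ : ∀ i, Measurable (θ i)) (hy : ∀ i, Measurable (y i))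
    -- the correctly specified model with true parameter `(β, A)`
    (β : FayHerriot.Cov p) (A : ℝ)
    (hmodel : ∀ i, FayHerriot.IsModel P β A (x i) (D i) (θ i) (y i))
    -- i.i.d. data and bounded sampling variances
    (hindep : iIndepFun (fun i ω => (y i ω, x i ω, D i ω)) P)
    (hident : ∀ i, IdentDistrib (fun ω => (y i ω, x i ω, D i ω))
      (fun ω => (y 0 ω, x 0 ω, D 0 ω)) P P)
    (DL DU : ℝ) (hDL : 0 < DL) (hDbd : ∀ i, ∀ᵐ ω ∂P, DL ≤ D i ω ∧ D i ω ≤ DU)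
    -- bounded covariates with positive definite second moment matrix
    (X : Set (FayHerriot.Cov p)) (hX : Bornology.IsBounded X) (hxX : ∀ i, ∀ᵐ ω ∂P, x i ω ∈ X)
    (hxpd : ∀ i, (Matrix.of fun j k : Fin p => ∫ ω, x i ω j * x i ω k ∂P).PosDef)
    -- compact parameter space containing the true parameter
    (Ψ : Set (FayHerriot.Param p)) (hΨ : IsCompact Ψ) (hΨpos : ∀ ψ ∈ Ψ, 0 < ψ.2)
    (hmem : (β, A) ∈ Ψ) (hA : (2 * Real.pi)⁻¹ * Real.exp (-3) < A + DL)
    -- normalising factor of the divergence: integral form or closed form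
    (c : ℝ → ℝ → ℝ → ℝ) (hc : c = FayHerriot.normIntegral ∨ c = FayHerriot.normClosed)
    -- finite set of candidates `0 = γ₁ < ⋯ < γ_M = 1`
    (Γ : Finset ℝ) (hΓ0 : (0 : ℝ) ∈ Γ) (hΓ1 : (1 : ℝ) ∈ Γ) (hΓ : ∀ γ ∈ Γ, 0 ≤ γ ∧ γ ≤ 1)
    -- estimators `ψhat γ m` from the first `m` areas, and selected value `γop m`
    (ψhat : ℝ → ℕ → Ω → FayHerriot.Param p) (hψm : ∀ γ ∈ Γ, ∀ m, Measurable (ψhat γ m))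
    (hψ : ∀ γ ∈ Γ, ∀ m, ∀ᵐ ω ∂P, FayHerriot.IsGammaEstimate c Ψ γ m
      (fun j => x j ω) (fun j => D j ω) (fun j => y j ω) (ψhat γ m ω))
    (γop : ℕ → Ω → ℝ) (hγm : ∀ m, Measurable (γop m))
    (hγ : ∀ m, ∀ᵐ ω ∂P, FayHerriot.IsOptimalGamma c Γ m (fun γ => ψhat γ m ω)
      (fun j => x j ω) (fun j => D j ω) (fun j => y j ω) (γop m ω))
    (α : ℝ) (hα0 : 0 < α) (hα1 : α < 1) (i : ℕ) :
    Tendsto (fun m : ℕ => P.real {ω | θ i ω ∈ FayHerriot.robustInterval c α (γop m ω)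
      (ψhat (γop m ω) m ω) (x i ω) (D i ω) (y i ω)}) atTop (𝓝 (1 - α)) := by
  obtain ⟨k, hk⟩ := FayHerriot.exists_isNormFactor hc
  have hApos : 0 < A := hΨpos _ hmem
  have hDpos : ∀ i, ∀ᵐ ω ∂P, 0 < D i ω := fun i => by
    filter_upwards [hDbd i] with ω hω using hDL.trans_le hω.1
  obtain ⟨B, hB⟩ := hX.exists_norm_le
  have hobs : FayHerriot.IsIIDObs P β A DL DU B x D y :=
    { obs := fun j =>
        { meas_x := hx j, meas_D := hD j, meas_y := hy j, A_pos := hApos, DL_pos := hDL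
          D_mem := hDbd j
          x_le := by filter_upwards [hxX j] with ω hω using hB _ hω
          law := (hmodel j).map_obs hApos (hx j) (hD j) (hθ j) (hy j) (hDpos j) }
      indep := hindep
      ident := hident }
  have hzero := hobs.eventually_optimalGamma_eq_zero hk (hxpd 0) hΨ hΨpos hmem hA hΓ0
    (fun γ hγ => (hΓ γ hγ).1) hψ hγ
  have hcons := hobs.tendsto_estimate hk (hxpd 0) hΨ hΨpos hmem le_rfl (hψ 0 hΓ0)
  have hlim := (hmodel i).tendsto_plainInterval hApos (hx i) (hD i) (hθ i) (hy i) (hDpos i)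
    (hψm 0 hΓ0) hcons (FayHerriot.upperQuantile (α / 2))
  rw [(hmodel i).measureReal_plainInterval hApos (hx i) (hD i) (hθ i) (hy i) (hDpos i)
    hα0 hα1] at hlim
  -- On the event that `0` is selected, the robust interval is the plain one at the estimate for `γ
  -- = 0`.
  refine FayHerriot.tendsto_measureReal_of_agree hlim
    (G := fun m => {ω | γop m ω = 0})
    (fun m => measurableSet_eq_fun (hγm m) measurable_const) hzero fun m => ?_
  filter_upwards [hψ 0 hΓ0 m, hDpos i] with ω hω hd hg
  change γop m ω = 0 at hg
  rw [hg, FayHerriot.robustInterval_zero hk (add_pos (hΨpos _ hω.1) hd)]
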